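/- Let $k$ be an algebraically closed field of characteristic $0$, let $l_1,l_2\in k$, let $(0,0,0)\neq(m_{11},m_{12},m_{13})\in k^3$, and let $$M=\begin{pmatrix} m_{11}&m_{12}&m_{13}\\ l_1m_{11}&l_1m_{12}&l_1m_{13}\\ l_2m_{11}&l_2m_{12}&l_2m_{13}\end{pmatrix}.$$ Let $\mathcal{A}$ be the connected cochain DG algebra whose underlying graded algebra is $$k\langle x_1,x_2,x_3\rangle/(x_1x_2+x_2x_1,\;x_2x_3+x_3x_2,\;x_3x_1+x_1x_3),\qquad |x_1|=|x_2|=|x_3|=1,$$ and whose differential (of degree $1$, $k$-linear, with $\partial(ab)=\partial(a)b+(-1)^{|a|}a\,\partial(b)$ for homogeneous $a$) is determined by $\partial(x_i)=\sum_{j=1}^3 M_{ij}x_j^2$. Let $H(\mathcal{A})=\bigoplus_i \ker\partial^i/\operatorname{im}\partial^{i-1}$ be its cohomology graded algebra. A connected graded $k$-algebra $A$ is called left AS-Gorenstein if $\dim_k\bigoplus_i\mathrm{Ext}^i_A(k,A)=1$ and $A$ has finite injective dimension as a left $A$-module; right AS-Gorenstein is defined in the same way with right modules; AS-Gorenstein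 means both. Then $H(\mathcal{A})$ is AS-Gorenstein if any one of the following conditions holds: 1. $m_{12}l_1^2+m_{13}l_2^2\neq m_{11}$ and $l_1l_2=0$; 2. $m_{12}l_1^2+m_{13}l_2^2=m_{11}$, $l_1\neq0$ and $l_2=0$; 3. $m_{12}l_1^2+m_{13}l_2^2=m_{11}$, $l_2\neq0$ and $l_1=0$; 4. $m_{12}l_1^2+m_{13}l_2^2=m_{11}$, $l_1=0$ and $l_2=0$; 5. $m_{12}l_1^2+m_{13}l_2^2=m_{11}$, $l_1l_2\neq0$ and $m_{12}m_{13}\neq0$; 6. $m_{12}l_1^2+m_{13}l_2^2\neq m_{11}$, $l_1l_2\neq0$ and $4m_{12}m_{13}l_1^2l_2^2\neq(m_{12}l_1^2+m_{13}l_2^2-m_{11})^2$. Moreover, at least one of these conditions holds if and only if it is not the case that $l_1l_2\neq0$ together with either $m_{12}m_{13}=0$ and $m_{12}l_1^2+m_{13}l_2^2=m_{11}$, or $m_{12}l_1^2+m_{13}l_2^2\neq m_{11}$ and $4m_{12}m_{13}l_1^2l_2^2=(m_{12}l_1^2+m_{13}l_2^2-m_{11})^2$. -/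

import Mathlib

open CategoryTheory
open scoped DirectSum

universe u

/-! ### Cochain DG algebras concentrated in non-negative degrees, and their cohomology -/

/-- A cochain DG algebra structure on a graded `k`-algebra `A = ⨁ 𝒜 i`: a `k`-linear differential
of degree `1`, of square zero, satisfying the graded Leibniz rule. -/
structure DGStructure (k : Type u) [Field k] {A : Type u} [Ring A] [Algebra k A]
    (𝒜 : ℕ → Submodule k A) [GradedAlgebra 𝒜] where
  d : A →ₗ[k] A
  d_mem : ∀ (i : ℕ) (a : A), a ∈ 𝒜 i → d a ∈ 𝒜 (i + 1)
  d_d : ∀ a : A, d (d a) = 0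
  leibniz : ∀ (i : ℕ) (a b : A), a ∈ 𝒜 i → d (a * b) = d a * b + (-1) ^ i * (a * d b)

namespace DGStructure

variable {k : Type u} [Field k] {A : Type u} [Ring A] [Algebra k A]
  {𝒜 : ℕ → Submodule k A} [GradedAlgebra 𝒜] (D : DGStructure k 𝒜)

theorem d_proj (a : A) (i : ℕ) :
    D.d (GradedRing.proj 𝒜 i a) = GradedRing.proj 𝒜 (i + 1) (D.d a) := by
  induction a using DirectSum.Decomposition.inductionOn 𝒜 with
  | zero => simp
  | @homogeneous j m =>
    simp only [GradedRing.proj_apply]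
    by_cases h : j = i
    · subst h
      rw [DirectSum.decompose_of_mem_same _ m.2,
        DirectSum.decompose_of_mem_same _ (D.d_mem _ _ m.2)]
    · rw [DirectSum.decompose_of_mem_ne _ m.2 h,
        DirectSum.decompose_of_mem_ne _ (D.d_mem _ _ m.2) (by omega), map_zero]
  | add a b ha hb => simp only [map_add, ha, hb]

theorem proj_zero_d (a : A) : GradedRing.proj 𝒜 0 (D.d a) = 0 := by
  induction a using DirectSum.Decomposition.inductionOn 𝒜 with
  | zero => simp
  | @homogeneous j m =>
    simp only [GradedRing.proj_apply]
    rw [DirectSum.decompose_of_mem_ne _ (D.d_mem _ _ m.2) (by omega)]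
  | add a b ha hb => simp only [map_add, ha, hb, add_zero]

theorem sum_proj (𝒜 : ℕ → Submodule k A) [GradedAlgebra 𝒜] (a : A) :
    ∃ s : Finset ℕ, ∑ i ∈ s, GradedRing.proj 𝒜 i a = a := by
  classical
  exact ⟨_, DirectSum.sum_support_decompose 𝒜 a⟩

theorem d_mul_of_right (a : A) {b : A} (hb : D.d b = 0) : D.d (a * b) = D.d a * b := by
  induction a using DirectSum.Decomposition.inductionOn 𝒜 with
  | zero => simp
  | @homogeneous j m => simp [D.leibniz j m b m.2, hb]
  | add a a' ha hb => simp only [map_add, add_mul, ha, hb]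

theorem d_one : D.d 1 = 0 := by
  have h := D.leibniz 0 1 1 (SetLike.GradedOne.one_mem)
  simpa using h

/-- The cocycles `ker ∂`, a subalgebra. -/
def cocycles : Subalgebra k A where
  carrier := {a | D.d a = 0}
  mul_mem' {a b} ha hb := by
    change D.d (a * b) = 0
    rw [D.d_mul_of_right a hb, show D.d a = 0 from ha, zero_mul]
  add_mem' {a b} ha hb := by
    change D.d (a + b) = 0
    rw [map_add, show D.d a = 0 from ha, show D.d b = 0 from hb, add_zero]
  algebraMap_mem' r := by
    change D.d (algebraMap k A r) = 0
    rw [Algebra.algebraMap_eq_smul_one, map_smul, D.d_one, smul_zero]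

theorem mem_cocycles {a : A} : a ∈ D.cocycles ↔ D.d a = 0 := Iff.rfl

theorem proj_mem_cocycles {a : A} (ha : a ∈ D.cocycles) (i : ℕ) :
    GradedRing.proj 𝒜 i a ∈ D.cocycles := by
  rw [mem_cocycles, d_proj, D.mem_cocycles.1 ha, map_zero]

/-- The coboundaries `im ∂`, an ideal of the algebra of cocycles. -/
def coboundaries : Ideal D.cocycles where
  carrier := {z | ∃ a : A, D.d a = z}
  add_mem' := by
    rintro z w ⟨a, ha⟩ ⟨b, hb⟩
    exact ⟨a + b, by rw [map_add, ha, hb]; rfl⟩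
  zero_mem' := ⟨0, by simp⟩
  smul_mem' := by
    rintro z w ⟨b, hb⟩
    obtain ⟨s, hs⟩ := sum_proj 𝒜 (z : A)
    refine ⟨∑ i ∈ s, (-1) ^ i * (GradedRing.proj 𝒜 i (z : A) * b), ?_⟩
    have key : ∀ i, D.d ((-1) ^ i * (GradedRing.proj 𝒜 i (z : A) * b))
        = GradedRing.proj 𝒜 i (z : A) * D.d b := by
      intro i
      have hz : D.d (GradedRing.proj 𝒜 i (z : A)) = 0 := D.proj_mem_cocycles z.2 i
      have h1 := D.leibniz i (GradedRing.proj 𝒜 i (z : A)) b (SetLike.coe_mem _)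
      rw [hz, zero_mul, zero_add] at h1
      rcases neg_one_pow_eq_or A i with h | h
      · rw [h, one_mul] at h1
        rw [h, one_mul, h1]
      · rw [h, neg_one_mul] at h1
        rw [h, neg_one_mul, map_neg, h1, neg_neg]
    rw [map_sum, Finset.sum_congr rfl fun i _ => key i, ← Finset.sum_mul, hs, hb]
    rfl

theorem mem_coboundaries {z : D.cocycles} : z ∈ D.coboundaries ↔ ∃ a : A, D.d a = z := Iff.rfl

instance : D.coboundaries.IsTwoSided where
  mul_mem_of_left := by
    rintro z w ⟨a, ha⟩
    exact ⟨a * w, by rw [D.d_mul_of_right a w.2, ha]; rfl⟩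

/-- The cohomology algebra `H(𝒜) = ker ∂ / im ∂`. -/
abbrev Cohomology : Type u := D.cocycles ⧸ D.coboundaries

/-- The class of a cocycle in the cohomology algebra. -/
def cohomologyClass : D.cocycles →ₐ[k] D.Cohomology := Ideal.Quotient.mkₐ k D.coboundaries

/-- `Hⁱ(𝒜)`: the classes of the cocycles of degree `i`. -/
def cohomologyGrading (i : ℕ) : Submodule k D.Cohomology :=
  ((𝒜 i).comap D.cocycles.val.toLinearMap).map D.cohomologyClass.toLinearMap

theorem mem_cohomologyGrading {i : ℕ} {x : D.Cohomology} :
    x ∈ D.cohomologyGrading i ↔ ∃ z : D.cocycles, (z : A) ∈ 𝒜 i ∧ D.cohomologyClass z = x :=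
  Iff.rfl

theorem cohomologyClass_surjective : Function.Surjective D.cohomologyClass :=
  Ideal.Quotient.mk_surjective

theorem cohomologyClass_eq_zero {z : D.cocycles} :
    D.cohomologyClass z = 0 ↔ ∃ a : A, D.d a = z :=
  Ideal.Quotient.eq_zero_iff_mem

instance : SetLike.GradedMonoid D.cohomologyGrading where
  one_mem := ⟨1, SetLike.GradedOne.one_mem (A := 𝒜), map_one D.cohomologyClass⟩
  mul_mem := by
    rintro i j _ _ ⟨z, hz, rfl⟩ ⟨w, hw, rfl⟩
    exact ⟨z * w, SetLike.GradedMul.mul_mem (A := 𝒜) hz hw, map_mul D.cohomologyClass z w⟩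

/-- The `i`-th homogeneous component of a cocycle. -/
def cocyclesProj (i : ℕ) : D.cocycles →+ D.cocycles where
  toFun z := ⟨GradedRing.proj 𝒜 i (z : A), D.proj_mem_cocycles z.2 i⟩
  map_zero' := by ext; simp
  map_add' z w := by ext; simp

theorem cocyclesProj_mem_coboundaries (i : ℕ) {z : D.cocycles} (hz : z ∈ D.coboundaries) :
    D.cocyclesProj i z ∈ D.coboundaries := by
  obtain ⟨a, ha⟩ := hz
  cases i with
  | zero => exact ⟨0, by rw [map_zero]; change _ = GradedRing.proj 𝒜 0 (z : A); rw [← ha, proj_zero_d]⟩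
  | succ i => exact ⟨GradedRing.proj 𝒜 i a, by rw [d_proj, ha]; rfl⟩

/-- The `i`-th homogeneous component of a cohomology class. -/
def cohomologyProj (i : ℕ) : D.Cohomology →+ D.Cohomology :=
  QuotientAddGroup.map D.coboundaries.toAddSubgroup D.coboundaries.toAddSubgroup
    (D.cocyclesProj i) fun _ hz => D.cocyclesProj_mem_coboundaries i hz

theorem cohomologyProj_class (i : ℕ) (z : D.cocycles) :
    D.cohomologyProj i (D.cohomologyClass z) = D.cohomologyClass (D.cocyclesProj i z) := rfl

theorem cohomologyProj_same {i : ℕ} {x : D.Cohomology} (hx : x ∈ D.cohomologyGrading i) :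
    D.cohomologyProj i x = x := by
  obtain ⟨z, hz, rfl⟩ := hx
  change D.cohomologyProj i (D.cohomologyClass z) = D.cohomologyClass z
  rw [cohomologyProj_class]
  congr 1
  ext
  exact DirectSum.decompose_of_mem_same 𝒜 hz

theorem cohomologyProj_ne {i j : ℕ} (h : i ≠ j) {x : D.Cohomology}
    (hx : x ∈ D.cohomologyGrading i) : D.cohomologyProj j x = 0 := by
  obtain ⟨z, hz, rfl⟩ := hx
  change D.cohomologyProj j (D.cohomologyClass z) = 0
  rw [cohomologyProj_class, show D.cocyclesProj j z = 0 from ?_, map_zero]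
  ext
  exact DirectSum.decompose_of_mem_ne 𝒜 hz h

theorem cohomologyGrading_isInternal : DirectSum.IsInternal D.cohomologyGrading := by
  classical
  constructor
  · rw [injective_iff_map_eq_zero]
    intro x hx
    have key : ∀ (j : ℕ) (y : ⨁ i, D.cohomologyGrading i),
        D.cohomologyProj j (DirectSum.coeAddMonoidHom D.cohomologyGrading y) = (y j : D.Cohomology) := by
      intro j y
      induction y using DirectSum.induction_on with
      | zero =>
        rw [(DirectSum.coeAddMonoidHom D.cohomologyGrading).map_zero,
          (D.cohomologyProj j).map_zero]
        rfl
      | of i y =>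
        rw [DirectSum.coeAddMonoidHom_of]
        by_cases h : i = j
        · subst h
          rw [D.cohomologyProj_same y.2, DirectSum.of_eq_same]
        · rw [D.cohomologyProj_ne h y.2, DirectSum.of_eq_of_ne _ _ _ (Ne.symm h)]
          rfl
      | add y z hy hz => rw [map_add, map_add, hy, hz]; rfl
    ext j
    rw [← key j x, hx, map_zero]
    rfl
  · intro x
    obtain ⟨z, rfl⟩ := D.cohomologyClass_surjective x
    obtain ⟨s, hs⟩ := sum_proj 𝒜 (z : A)
    refine ⟨∑ i ∈ s, DirectSum.of (fun i => D.cohomologyGrading i) i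
      ⟨D.cohomologyClass (D.cocyclesProj i z), D.cocyclesProj i z, SetLike.coe_mem (DirectSum.decompose 𝒜 (z : A) i), rfl⟩, ?_⟩
    rw [map_sum, Finset.sum_congr rfl fun i _ => DirectSum.coeAddMonoidHom_of _ _ _, ← map_sum]
    congr 1
    ext
    rw [AddSubmonoidClass.coe_finsetSum]
    exact hs

noncomputable instance : GradedAlgebra D.cohomologyGrading where
  toDecomposition := D.cohomologyGrading_isInternal.chooseDecomposition

end DGStructure

/-! ### Artin-Schelter Gorenstein graded algebras -/

open scoped ModuleCat in
/-- For a `k`-algebra `R` and an `R`-module `A` with a set `S` of elements of `A`: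
`dim_k Ext_R^*(A / RS, A) = 1`, where `Ext_R^* = ⨁ i, Ext_R^i`, and the injective dimension of
the `R`-module `A` is finite. -/
def ExtOneInjFinite (k : Type u) [Field k] (R : Type u) [Ring R] [Algebra k R]
    (A : Type u) [AddCommGroup A] [Module R A] (S : Set A) : Prop :=
  Module.rank k (⨁ i : ℕ, Abelian.Ext.{u} (ModuleCat.of R (A ⧸ Submodule.span R S))
    (ModuleCat.of R A) i) = 1 ∧
  injectiveDimension (ModuleCat.of R A) < ⊤

/-- A graded algebra is connected if its degree zero part is `k` (and `k ≠ 0` embeds). -/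
def IsConnectedGraded {k A : Type u} [Field k] [Ring A] [Algebra k A]
    (𝒢 : ℕ → Submodule k A) : Prop :=
  Nontrivial A ∧ 𝒢 0 = 1

/-- The homogeneous elements of positive degree. They span the augmentation ideal `A_{>0}`, and
for connected `A` the trivial module is `k = A / A_{>0}`. -/
def positivePart {k A : Type u} [Field k] [Ring A] [Algebra k A]
    (𝒢 : ℕ → Submodule k A) : Set A := {a | ∃ i, 0 < i ∧ a ∈ 𝒢 i}

/-- Left Artin-Schelter Gorenstein: `dim_k Ext_A^*(k, A) = 1` and `id_A A < ∞`, for left modules. -/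
def IsLeftASGorenstein {k A : Type u} [Field k] [Ring A] [Algebra k A]
    (𝒢 : ℕ → Submodule k A) [GradedAlgebra 𝒢] : Prop :=
  IsConnectedGraded 𝒢 ∧ ExtOneInjFinite k A A (positivePart 𝒢)

/-- Right Artin-Schelter Gorenstein: the same for right modules, that is, modules over `Aᵐᵒᵖ`. -/
def IsRightASGorenstein {k A : Type u} [Field k] [Ring A] [Algebra k A]
    (𝒢 : ℕ → Submodule k A) [GradedAlgebra 𝒢] : Prop :=
  IsConnectedGraded 𝒢 ∧ ExtOneInjFinite k Aᵐᵒᵖ A (positivePart 𝒢)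

/-- Artin-Schelter Gorenstein, on both sides. -/
def IsASGorenstein {k A : Type u} [Field k] [Ring A] [Algebra k A]
    (𝒢 : ℕ → Submodule k A) [GradedAlgebra 𝒢] : Prop :=
  IsLeftASGorenstein 𝒢 ∧ IsRightASGorenstein 𝒢

/-! ### The skew polynomial algebra in three variables and its DG structures -/

/-- The relations `x_i x_j + x_j x_i = 0`, `i ≠ j`, in `k⟨x_1, x_2, x_3⟩`. -/
inductive SkewRel (k : Type u) [Field k] : FreeAlgebra k (Fin 3) → FreeAlgebra k (Fin 3) → Prop
  | anticomm (i j : Fin 3) (h : i ≠ j) : SkewRel k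
      (FreeAlgebra.ι k i * FreeAlgebra.ι k j + FreeAlgebra.ι k j * FreeAlgebra.ι k i) 0

/-- `k⟨x_1, x_2, x_3⟩ / (x_1 x_2 + x_2 x_1, x_2 x_3 + x_3 x_2, x_3 x_1 + x_1 x_3)`. -/
def SkewPoly (k : Type u) [Field k] : Type u := RingQuot (SkewRel k)

namespace SkewPoly

variable (k : Type u) [Field k]

instance : Ring (SkewPoly k) := inferInstanceAs (Ring (RingQuot (SkewRel k)))

instance : Algebra k (SkewPoly k) := inferInstanceAs (Algebra k (RingQuot (SkewRel k)))

/-- The quotient map. -/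
def mk : FreeAlgebra k (Fin 3) →ₐ[k] SkewPoly k := RingQuot.mkAlgHom k (SkewRel k)

/-- The generators. -/
def x (i : Fin 3) : SkewPoly k := mk k (FreeAlgebra.ι k i)

theorem x_anticomm {i j : Fin 3} (h : i ≠ j) : x k i * x k j + x k j * x k i = 0 := by
  have : mk k _ = mk k _ := RingQuot.mkAlgHom_rel k (SkewRel.anticomm (k := k) i j h)
  simpa [x] using this

variable {k} in
/-- The universal property of the presentation. -/
def lift {B : Type u} [Ring B] [Algebra k B] (f : Fin 3 → B)
    (hf : ∀ i j, i ≠ j → f i * f j + f j * f i = 0) : SkewPoly k →ₐ[k] B :=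
  RingQuot.liftAlgHom k ⟨FreeAlgebra.lift k f, by
    rintro _ _ ⟨i, j, h⟩
    simpa using hf i j h⟩

variable {k} in
@[simp]
theorem lift_x {B : Type u} [Ring B] [Algebra k B] (f : Fin 3 → B)
    (hf : ∀ i j, i ≠ j → f i * f j + f j * f i = 0) (i : Fin 3) : lift f hf (x k i) = f i := by
  have : lift f hf (mk k (FreeAlgebra.ι k i)) = FreeAlgebra.lift k f (FreeAlgebra.ι k i) :=
    RingQuot.liftAlgHom_mkAlgHom_apply k _ _ _
  rw [x, this, FreeAlgebra.lift_ι_apply]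

variable {k} in
theorem algHom_ext {B : Type u} [Ring B] [Algebra k B] {f g : SkewPoly k →ₐ[k] B}
    (h : ∀ i, f (x k i) = g (x k i)) : f = g := by
  refine RingQuot.ringQuot_ext' k f g ?_
  ext i
  exact h i

/-- The degree `n` part: the span of the products of `n` generators, as each `x_i` has
degree `1`. -/
def grading (n : ℕ) : Submodule k (SkewPoly k) := Submodule.span k (Set.range (x k)) ^ n

theorem x_mem (i : Fin 3) : x k i ∈ grading k 1 := by
  rw [grading, pow_one]
  exact Submodule.subset_span ⟨i, rfl⟩

instance : SetLike.GradedMonoid (grading k) :=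
  Submodule.nat_power_gradedMonoid (Submodule.span k (Set.range (x k)))

/-- The map `A → ⨁ A_n` that exhibits the grading. -/
def toDirectSum : SkewPoly k →ₐ[k] ⨁ n, grading k n :=
  lift (fun i => DirectSum.of (fun n => grading k n) 1 ⟨x k i, x_mem k i⟩) <| by
    intro i j h
    rw [DirectSum.of_mul_of, DirectSum.of_mul_of, ← map_add]
    refine (congrArg (DirectSum.of (fun n => grading k n) (1 + 1)) ?_).trans
      (map_zero (DirectSum.of (fun n => grading k n) (1 + 1)))
    exact Subtype.ext (x_anticomm k h)

theorem toDirectSum_of_mem_one {m : SkewPoly k} (hm : m ∈ Submodule.span k (Set.range (x k)))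
    (hm' : m ∈ grading k 1) :
    toDirectSum k m = DirectSum.of (fun n => grading k n) 1 ⟨m, hm'⟩ := by
  have h : ∀ (m : SkewPoly k) (_ : m ∈ Submodule.span k (Set.range (x k))),
      ∃ h : m ∈ grading k 1, toDirectSum k m = DirectSum.lof k ℕ (fun n => grading k n) 1 ⟨m, h⟩ := by
    intro m hm
    induction hm using Submodule.span_induction with
    | mem y hy =>
      obtain ⟨i, rfl⟩ := hy
      exact ⟨x_mem k i, lift_x _ _ i⟩
    | zero => exact ⟨zero_mem _, by rw [map_zero]; exact (map_zero _).symm⟩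
    | add y z _ _ hy hz =>
      obtain ⟨hy, ey⟩ := hy
      obtain ⟨hz, ez⟩ := hz
      exact ⟨add_mem hy hz, by rw [map_add, ey, ez, ← map_add]; rfl⟩
    | smul c y _ hy =>
      obtain ⟨hy, ey⟩ := hy
      exact ⟨Submodule.smul_mem _ c hy, by rw [map_smul, ey, ← map_smul]; rfl⟩
  exact (h m hm).2

theorem toDirectSum_of_mem (n : ℕ) (a : grading k n) :
    toDirectSum k a = DirectSum.of (fun n => grading k n) n a := by
  obtain ⟨a, ha⟩ := a
  dsimp only
  induction ha using Submodule.pow_induction_on_left' with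
  | algebraMap => simp_rw [AlgHom.commutes, DirectSum.algebraMap_apply]; rfl
  | add _ _ _ _ _ ihx ihy => simp_rw [map_add, ihx, ihy, ← map_add]; rfl
  | mem_mul m hm i y hy ih =>
    have hm' : m ∈ grading k 1 := by rw [grading, pow_one]; exact hm
    simp_rw [map_mul, ih, toDirectSum_of_mem_one k hm hm', DirectSum.of_mul_of]
    exact DirectSum.of_eq_of_gradedMonoid_eq (Sigma.subtype_ext (add_comm _ _) rfl)

instance gradedAlgebra : GradedAlgebra (grading k) :=
  GradedAlgebra.ofAlgHom _ (toDirectSum k)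
    (algHom_ext fun i => by
      rw [AlgHom.comp_apply, toDirectSum_of_mem_one k (Submodule.subset_span ⟨i, rfl⟩) (x_mem k i),
        DirectSum.coeAlgHom_of]
      rfl)
    (toDirectSum_of_mem k)

variable {k}

@[elab_as_elim]
theorem grading_induction {P : ∀ (n : ℕ) (a : SkewPoly k), a ∈ grading k n → Prop}
    (algebraMap : ∀ r h, P 0 (algebraMap k _ r) h)
    (add : ∀ n a b ha hb h, P n a ha → P n b hb → P n (a + b) h)
    (smul : ∀ n (c : k) a ha h, P n a ha → P n (c • a) h)
    (x_mul : ∀ n i a ha h, P n a ha → P (n + 1) (x k i * a) h)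
    {n : ℕ} {a : SkewPoly k} (ha : a ∈ grading k n) : P n a ha := by
  induction ha using Submodule.pow_induction_on_left' with
  | algebraMap r => exact algebraMap r _
  | add y z i hy hz ihy ihz => exact add i y z hy hz _ ihy ihz
  | mem_mul m hm i y hy ih =>
    have key : ∀ (m : SkewPoly k) (_ : m ∈ Submodule.span k (Set.range (x k))),
        ∃ h : m * y ∈ grading k (i + 1), P (i + 1) (m * y) h := by
      intro m hm
      have mem : ∀ m ∈ Submodule.span k (Set.range (x k)), m * y ∈ grading k (i + 1) := by
        intro m hm
        rw [grading, pow_succ']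
        exact Submodule.mul_mem_mul hm hy
      induction hm using Submodule.span_induction with
      | mem w hw =>
        obtain ⟨j, rfl⟩ := hw
        exact ⟨mem _ (Submodule.subset_span ⟨j, rfl⟩), x_mul i j y hy _ ih⟩
      | zero =>
        have h0 := mem 0 (zero_mem _)
        refine ⟨h0, ?_⟩
        obtain ⟨j⟩ : Nonempty (Fin 3) := inferInstance
        have hj := mem _ (Submodule.subset_span ⟨j, rfl⟩)
        have h1 : P (i + 1) ((0 : k) • (x k j * y)) (Submodule.smul_mem _ _ hj) :=
          smul _ 0 _ hj _ (x_mul i j y hy hj ih)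
        have e : (0 : k) • (x k j * y) = 0 * y := by simp
        revert h0
        rw [← e]
        exact fun _ => h1
      | add v w _ _ hv hw =>
        obtain ⟨hv, pv⟩ := hv
        obtain ⟨hw, pw⟩ := hw
        simp only [add_mul]
        exact ⟨add_mem hv hw, add _ _ _ hv hw _ pv pw⟩
      | smul c v _ hv =>
        obtain ⟨hv, pv⟩ := hv
        simp only [smul_mul_assoc]
        exact ⟨Submodule.smul_mem _ c hv, smul _ c _ hv _ pv⟩
    exact (key m hm).2

theorem x_sq_comm (i j : Fin 3) : x k j ^ 2 * x k i = x k i * x k j ^ 2 := by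
  by_cases h : i = j
  · subst h; rw [← pow_succ, ← pow_succ']
  · have e : x k j * x k i = -(x k i * x k j) := by
      rw [eq_neg_iff_add_eq_zero, x_anticomm k (Ne.symm h)]
    rw [pow_two, mul_assoc, e, mul_neg, ← mul_assoc, e, neg_mul, neg_neg, mul_assoc]

/-- The prescribed value `∂(x_i) = ∑ j, M i j • x_j ^ 2`. -/
def dx (M : Matrix (Fin 3) (Fin 3) k) (i : Fin 3) : SkewPoly k := ∑ j, M i j • x k j ^ 2

theorem dx_mem (M : Matrix (Fin 3) (Fin 3) k) (i : Fin 3) : dx M i ∈ grading k 2 := by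
  refine Submodule.sum_mem _ fun j _ => Submodule.smul_mem _ _ ?_
  rw [pow_two]
  exact SetLike.GradedMul.mul_mem (x_mem k j) (x_mem k j)

theorem dx_comm (M : Matrix (Fin 3) (Fin 3) k) (i j : Fin 3) :
    dx M i * x k j = x k j * dx M i := by
  simp only [dx, Finset.sum_mul, Finset.mul_sum, smul_mul_assoc, mul_smul_comm, x_sq_comm]

/-- A skew derivation `∂` with `∂(ab) = ∂(a) b + σ(a) ∂(b)` is the upper right entry of an algebra
homomorphism `a ↦ (σ(a), ∂(a); 0, a)` to upper triangular matrices. -/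
def matrixHom (M : Matrix (Fin 3) (Fin 3) k) :
    SkewPoly k →ₐ[k] Matrix (Fin 2) (Fin 2) (SkewPoly k) :=
  lift (fun i => !![-x k i, dx M i; 0, x k i]) <| by
    intro i j h
    have e := x_anticomm k h
    have e2 : -(x k i * dx M j) + dx M i * x k j + (-(x k j * dx M i) + dx M j * x k i) = 0 := by
      rw [dx_comm, dx_comm]; abel
    ext a b
    fin_cases a <;> fin_cases b <;> simp [e, e2]

theorem matrixHom_x (M : Matrix (Fin 3) (Fin 3) k) (i : Fin 3) :
    matrixHom M (x k i) = !![-x k i, dx M i; 0, x k i] := lift_x _ _ i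

theorem matrixHom_of_mem (M : Matrix (Fin 3) (Fin 3) k) {n : ℕ} {a : SkewPoly k}
    (ha : a ∈ grading k n) : matrixHom M a 0 0 = (-1) ^ n * a ∧ matrixHom M a 1 0 = 0 ∧
      matrixHom M a 1 1 = a ∧ matrixHom M a 0 1 ∈ grading k (n + 1) := by
  induction ha using grading_induction with
  | algebraMap r => simp [Matrix.algebraMap_matrix_apply]
  | add n a b ha hb _ iha ihb =>
    obtain ⟨a1, a2, a3, a4⟩ := iha
    obtain ⟨b1, b2, b3, b4⟩ := ihb
    simp only [map_add, Matrix.add_apply, a1, a2, a3, b1, b2, b3]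
    exact ⟨(mul_add _ _ _).symm, add_zero _, trivial, add_mem a4 b4⟩
  | smul n c a ha _ iha =>
    obtain ⟨a1, a2, a3, a4⟩ := iha
    simp only [map_smul, Matrix.smul_apply, a1, a2, a3]
    exact ⟨(mul_smul_comm _ _ _).symm, smul_zero _, trivial, Submodule.smul_mem _ _ a4⟩
  | x_mul n i a ha _ iha =>
    obtain ⟨a1, a2, a3, a4⟩ := iha
    simp only [map_mul, matrixHom_x, Matrix.mul_apply, Fin.sum_univ_two, a1, a2, a3]
    refine ⟨?_, by simp, by simp, ?_⟩
    · have : (-1 : SkewPoly k) ^ n * x k i = x k i * (-1) ^ n :=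
        ((Commute.neg_one_left _).pow_left n).eq
      simp [pow_succ, ← mul_assoc, this]
    · refine add_mem ?_ ?_
      · have := SetLike.GradedMul.mul_mem (x_mem k i) a4
        simp only [Matrix.of_apply, Matrix.cons_val', Matrix.cons_val_zero, neg_mul]
        rw [show n + 1 + 1 = 1 + (n + 1) by omega]
        exact neg_mem this
      · have := SetLike.GradedMul.mul_mem (dx_mem M i) ha
        rw [show n + 1 + 1 = 2 + n by omega]
        simpa using this

/-- The differential with `∂(x_i) = ∑ j, M i j • x_j ^ 2`. -/
def differential (M : Matrix (Fin 3) (Fin 3) k) : SkewPoly k →ₗ[k] SkewPoly k where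
  toFun a := matrixHom M a 0 1
  map_add' a b := by simp
  map_smul' c a := by simp

theorem matrixHom_one_one (M : Matrix (Fin 3) (Fin 3) k) (a : SkewPoly k) :
    matrixHom M a 1 1 = a := by
  induction a using DirectSum.Decomposition.inductionOn (grading k) with
  | zero => simp
  | homogeneous m => exact (matrixHom_of_mem M m.2).2.2.1
  | add a b ha hb => rw [map_add, Matrix.add_apply, ha, hb]

theorem differential_x (M : Matrix (Fin 3) (Fin 3) k) (i : Fin 3) :
    differential M (x k i) = ∑ j, M i j • x k j ^ 2 := by
  change matrixHom M (x k i) 0 1 = _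
  rw [matrixHom_x]; rfl

theorem differential_mul (M : Matrix (Fin 3) (Fin 3) k) {n : ℕ} {a : SkewPoly k}
    (ha : a ∈ grading k n) (b : SkewPoly k) :
    differential M (a * b) = differential M a * b + (-1) ^ n * (a * differential M b) := by
  change matrixHom M (a * b) 0 1 = _
  rw [map_mul, Matrix.mul_apply, Fin.sum_univ_two, (matrixHom_of_mem M ha).1,
    matrixHom_one_one, add_comm, mul_assoc]
  rfl

theorem differential_differential (M : Matrix (Fin 3) (Fin 3) k) (a : SkewPoly k) :
    differential M (differential M a) = 0 := by
  have sq : ∀ j, differential M (x k j ^ 2) = 0 := by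
    intro j
    rw [pow_two, differential_mul M (x_mem k j), differential_x]
    change dx M j * x k j + (-1) ^ 1 * (x k j * dx M j) = 0
    rw [dx_comm]; simp
  have h1 : ∀ i, differential M (differential M (x k i)) = 0 := by
    intro i
    simp [differential_x, map_sum, sq]
  have h : ∀ (n : ℕ) (a : SkewPoly k), a ∈ grading k n →
      differential M (differential M a) = 0 := by
    intro n a ha
    induction ha using grading_induction with
    | algebraMap r =>
      have : differential M (algebraMap k (SkewPoly k) r) = 0 := by
        change matrixHom M _ 0 1 = 0
        simp [Matrix.algebraMap_matrix_apply]
      rw [this, map_zero]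
    | add n a b _ _ _ iha ihb => simp [iha, ihb]
    | smul n c a _ _ iha => simp [iha]
    | x_mul n i a ha _ iha =>
      have hd : differential M (x k i) ∈ grading k 2 := by
        rw [differential_x]; exact dx_mem M i
      rw [differential_mul M (x_mem k i), map_add, differential_mul M hd, h1 i]
      simp [differential_mul M (x_mem k i), iha]
  induction a using DirectSum.Decomposition.inductionOn (grading k) with
  | zero => simp
  | homogeneous m => exact h _ _ m.2
  | add a b ha hb => simp [ha, hb]

/-- The DG algebra `𝒜_{O_{-1}(k³)}(M)`: the skew polynomial algebra with the differential
determined by `∂(x_i) = ∑ j, M i j • x_j ^ 2`. -/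
def dg (M : Matrix (Fin 3) (Fin 3) k) : DGStructure k (grading k) where
  d := differential M
  d_mem _ _ ha := (matrixHom_of_mem M ha).2.2.2
  d_d := differential_differential M
  leibniz _ _ b ha := differential_mul M ha b

theorem dg_d_x (M : Matrix (Fin 3) (Fin 3) k) (i : Fin 3) :
    (dg M).d (x k i) = ∑ j, M i j • x k j ^ 2 := differential_x M i

end SkewPoly

/-- The six conditions on a rank one matrix with first row `(m₁₁, m₁₂, m₁₃)` and second and third
rows `l₁` and `l₂` times the first. -/
def ListedCondition {k : Type u} [Field k] (m₁₁ m₁₂ m₁₃ l₁ l₂ : k) : Prop :=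
  (m₁₂ * l₁ ^ 2 + m₁₃ * l₂ ^ 2 ≠ m₁₁ ∧ l₁ * l₂ = 0) ∨
  (m₁₂ * l₁ ^ 2 + m₁₃ * l₂ ^ 2 = m₁₁ ∧ l₁ ≠ 0 ∧ l₂ = 0) ∨
  (m₁₂ * l₁ ^ 2 + m₁₃ * l₂ ^ 2 = m₁₁ ∧ l₂ ≠ 0 ∧ l₁ = 0) ∨
  (m₁₂ * l₁ ^ 2 + m₁₃ * l₂ ^ 2 = m₁₁ ∧ l₁ = 0 ∧ l₂ = 0) ∨
  (m₁₂ * l₁ ^ 2 + m₁₃ * l₂ ^ 2 = m₁₁ ∧ l₁ * l₂ ≠ 0 ∧ m₁₂ * m₁₃ ≠ 0) ∨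
  (m₁₂ * l₁ ^ 2 + m₁₃ * l₂ ^ 2 ≠ m₁₁ ∧ l₁ * l₂ ≠ 0 ∧
    4 * m₁₂ * m₁₃ * l₁ ^ 2 * l₂ ^ 2 ≠ (m₁₂ * l₁ ^ 2 + m₁₃ * l₂ ^ 2 - m₁₁) ^ 2)

/-! ### Coextension of scalars and injective dimension -/

namespace ModuleCat

/-! Number the variables `x_0, x_1, x_2` and write `q = ∑ m_j x_j²`, a central element, and `v = (1,
l₁, l₂)`. As `∂(x_i) = v_i q`, the differential is `q` times the contraction with `v`, the skew
derivation of degree `-1` sending `x_i` to `v_i` (`dg_d_eq`). Let `B` be the algebra generated by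
the squares and by `a = x_1 - l₁ x_0`, `b = x_2 - l₂ x_0`. It is free over `S = k[x_0², x_1², x_2²]`
with basis `1, a, b, ab`, and the whole algebra is `B + x_0 B`. The contraction kills `B` and sends
`x_0 c` to `c` for `c` in `B`, so its kernel and its image are both `B`. Since `S` is a domain and
`q ≠ 0`, the cocycles are `B`, the coboundaries are `qB`, and the cohomology is `H = B/qB`.

Some `m_p` is nonzero, so `q = 0` can be solved for `x_p²` and `S/q` is a polynomial ring `P` in two
variables. Thus `H` is free over the central subring `P` on `1, a, b, ab`, and `a²`, `b²`, `ab + ba`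
are elements of `P` without constant term (`isRankTwoClifford`).

Both halves of the Gorenstein property follow from this Clifford structure. The coefficient of `ab`
defines a perfect pairing, so `H ≅ Hom_P(H, P)`; coextension along `P → H` preserves injectives and
exact sequences, hence the injective dimension of `H` is at most that of `P`, which is at most `2`.
The two variables of `P` form a central regular sequence on `H` that kills `k`. Two dimension shifts
therefore identify `Ext²(k, H)` with `Hom(k, H/(X₀, X₁)H)`, the socle of an exterior algebra on `a`
and `b`, which is the line through `ab`. `Ext⁰` and `Ext¹` vanish by regularity, and `Extⁿ` for `n ≥
3` by the bound on the injective dimension (`extOneInjFinite`). The opposite ring has the same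
shape, which settles right modules.

The final equivalence between lists of conditions is propositional logic. -/

theorem coextendScalars_preservesInjectiveObjects {R S : Type u} [Ring R] [Ring S] (f : R →+* S) :
    (coextendScalars.{u, u, u} f).PreservesInjectiveObjects :=
  Functor.preservesInjectiveObjects_of_adjunction_of_preservesMonomorphisms
    (restrictCoextendScalarsAdj.{u, u, u} f)

/-- Coextension is `Hom_R(S, -)`, which is always left exact; surjectivity on the right is the
lifting property of the projective `R`-module `S`. -/
theorem shortExact_coextendScalars {R S : Type u} [Ring R] [Ring S] (f : R →+* S)
    [Module.Projective R ((restrictScalars f).obj (of S S))]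
    {T : ShortComplex (ModuleCat.{u} R)} (hT : T.ShortExact)
    (w : (coextendScalars f).map T.f ≫ (coextendScalars f).map T.g = 0) :
    (ShortComplex.mk _ _ w).ShortExact := by
  have hex := (ShortComplex.ShortExact.moduleCat_exact_iff_function_exact T).1 hT.exact
  have hinj := hT.moduleCat_injective_f
  have hsurj := hT.moduleCat_surjective_g
  refine shortComplex_shortExact _ ?_ ?_ ?_
  · intro h
    constructor
    · intro hh
      have h0 : ∀ s : S, T.g (CoextendScalars.equiv f _ h s) = 0 := fun s =>
        LinearMap.congr_fun (congrArg (CoextendScalars.equiv f _) hh) s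
      refine ⟨(CoextendScalars.equiv f _).symm
        ((LinearEquiv.ofInjective T.f.hom hinj).symm.toLinearMap ∘ₗ
          (CoextendScalars.equiv f _ h).codRestrict (LinearMap.range T.f.hom)
            fun s => (hex _).1 (h0 s)), ?_⟩
      apply CoextendScalars.ext
      ext s
      exact congrArg Subtype.val ((LinearEquiv.ofInjective T.f.hom hinj).apply_symm_apply _)
    · rintro ⟨h, rfl⟩
      exact ConcreteCategory.congr_hom w h
  · intro g h e
    apply CoextendScalars.ext
    ext s
    exact hinj (LinearMap.congr_fun (congrArg (CoextendScalars.equiv f _) e) s)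
  · intro h
    obtain ⟨g, hg⟩ := Module.projective_lifting_property T.g.hom (CoextendScalars.equiv f _ h) hsurj
    refine ⟨(CoextendScalars.equiv f _).symm g, ?_⟩
    apply CoextendScalars.ext
    exact hg

/-- Induction by dimension shifting: embed `N` in an injective module and pass to the cokernel.
Coextension keeps the sequence exact, and keeps its middle term injective because it is right
adjoint to the exact restriction functor. -/
theorem hasInjectiveDimensionLE_coextendScalars {R S : Type u} [Ring R] [Ring S] (f : R →+* S)
    [Module.Projective R ((restrictScalars f).obj (of S S))] (n : ℕ) (N : ModuleCat.{u} R)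
    (hN : HasInjectiveDimensionLE N n) : HasInjectiveDimensionLE ((coextendScalars f).obj N) n := by
  have hP := coextendScalars_preservesInjectiveObjects f
  induction n generalizing N with
  | zero =>
    simp only [HasInjectiveDimensionLE, zero_add, ← injective_iff_hasInjectiveDimensionLT_one]
      at hN ⊢
    exact hP.injective_obj hN
  | succ n ih =>
    obtain ⟨I, inj, i, mono⟩ := (inferInstance : EnoughInjectives (ModuleCat.{u} R)).1 N
    let T := ShortComplex.mk i (Limits.cokernel.π i) (Limits.cokernel.condition i)
    have hT : T.ShortExact := { exact := ShortComplex.exact_cokernel i }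
    have w : (coextendScalars f).map T.f ≫ (coextendScalars f).map T.g = 0 := by
      rw [← Functor.map_comp, T.zero]
      rfl
    have hFT := shortExact_coextendScalars f hT w
    have h3 := (hT.hasInjectiveDimensionLT_X₃_iff n inj).2 hN
    exact (hFT.hasInjectiveDimensionLT_X₃_iff n (hP.injective_obj inj)).1 (ih _ h3)

end ModuleCat

/-! ### Injective dimension over polynomial rings -/

namespace ModuleCat

/-- Elements of `Hom_R(S, N)` for an `S`-module `N`, as additive maps. -/
noncomputable def coextEval {R S : Type u} [Ring R] [Ring S] {f : R →+* S} {N : ModuleCat.{u} S}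
    (g : (coextendScalars f).obj ((restrictScalars f).obj N)) : S →+ N where
  toFun s := CoextendScalars.equiv f _ g s
  map_zero' := map_zero (CoextendScalars.equiv f _ g)
  map_add' := map_add (CoextendScalars.equiv f _ g)

/-- Elements of `Hom_R(S, N)` for an `S`-module `N`, from additive maps. -/
noncomputable def coextMk {R S : Type u} [Ring R] [Ring S] {f : R →+* S} {N : ModuleCat.{u} S}
    (h : S →+ N) (hh : ∀ r s, h (f r * s) = f r • h s) :
    (coextendScalars f).obj ((restrictScalars f).obj N) :=
  (CoextendScalars.equiv f _).symm { toFun := h, map_add' := map_add h, map_smul' := hh }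

section

variable {R S : Type u} [Ring R] [Ring S] {f : R →+* S} {N : ModuleCat.{u} S}

theorem coextEval_mk (h : S →+ N) (hh : ∀ r s, h (f r * s) = f r • h s) (s : S) :
    coextEval (coextMk h hh) s = h s := rfl

theorem coext_ext {g h : (coextendScalars f).obj ((restrictScalars f).obj N)}
    (e : ∀ s, coextEval g s = coextEval h s) : g = h :=
  CoextendScalars.ext (LinearMap.ext e)

theorem coextEval_scalar (g : (coextendScalars f).obj ((restrictScalars f).obj N)) (r : R) (s : S) :
    coextEval g (f r * s) = f r • coextEval g s :=
  (CoextendScalars.equiv f _ g).map_smul r s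

theorem coextEval_add (g h : (coextendScalars f).obj ((restrictScalars f).obj N)) (s : S) :
    coextEval (g + h) s = coextEval g s + coextEval h s := rfl

theorem coextEval_smul (g : (coextendScalars f).obj ((restrictScalars f).obj N)) (t s : S) :
    coextEval (t • g) s = coextEval g (s * t) := rfl

end

open Polynomial in
/-- For an `S[X]`-module `N`, the map `g ↦ (p ↦ g (X * p) - X • g p)` on `Hom_S(S[X], N)`, whose
kernel is `N`. -/
noncomputable def polynomialCoextDiff {S : Type u} [CommRing S] (N : ModuleCat.{u} S[X]) :
    (coextendScalars (C : S →+* S[X])).obj ((restrictScalars C).obj N) →ₗ[S[X]]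
      (coextendScalars (C : S →+* S[X])).obj ((restrictScalars C).obj N) where
  toFun g := coextMk ((coextEval g).comp (AddMonoidHom.mulLeft X) -
      (DistribSMul.toAddMonoidHom N (X : S[X])).comp (coextEval g)) fun r p => by
    have e1 : (X * (C r * p) : S[X]) = C r * (X * p) := by ring
    simp only [AddMonoidHom.sub_apply, AddMonoidHom.comp_apply, AddMonoidHom.coe_mulLeft,
      DistribSMul.toAddMonoidHom_apply]
    rw [e1, coextEval_scalar, coextEval_scalar, smul_sub, smul_comm X (C r)]
  map_add' g h := coext_ext fun p => by
    simp only [AddMonoidHom.sub_apply, AddMonoidHom.comp_apply, AddMonoidHom.coe_mulLeft,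
      DistribSMul.toAddMonoidHom_apply, coextEval_mk, coextEval_add, smul_add]
    abel
  map_smul' q g := coext_ext fun p => by
    simp only [AddMonoidHom.sub_apply, AddMonoidHom.comp_apply, AddMonoidHom.coe_mulLeft,
      DistribSMul.toAddMonoidHom_apply, coextEval_mk, coextEval_smul, RingHom.id_apply, mul_assoc]

open Polynomial in
theorem polynomialCoextDiff_apply {S : Type u} [CommRing S] (N : ModuleCat.{u} S[X])
    (g : (coextendScalars (C : S →+* S[X])).obj ((restrictScalars C).obj N)) (p : S[X]) :
    coextEval (polynomialCoextDiff N g) p = coextEval g (X * p) - (X : S[X]) • coextEval g p := rfl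

open Polynomial in
theorem coextEval_monomial {S : Type u} [CommRing S] {N : ModuleCat.{u} S[X]}
    {g h : (coextendScalars (C : S →+* S[X])).obj ((restrictScalars C).obj N)}
    (e : ∀ i : ℕ, coextEval g (X ^ i) = coextEval h (X ^ i)) : g = h := by
  refine coext_ext fun p => ?_
  induction p using Polynomial.induction_on' with
  | add p q hp hq => rw [map_add, map_add, hp, hq]
  | monomial i a =>
    rw [← C_mul_X_pow_eq_monomial, coextEval_scalar, coextEval_scalar, e]

open Polynomial in
/-- The `S`-module `S[X]`, as a restriction of scalars. -/
noncomputable def polynomialRestrictEquiv (S : Type u) [CommRing S] :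
    S[X] ≃ₗ[S] (restrictScalars (C : S →+* S[X])).obj (of S[X] S[X]) where
  toFun p := p
  invFun p := p
  map_add' _ _ := rfl
  map_smul' r p := (smul_eq_C_mul r : r • p = C r * p)

open Polynomial in
theorem polynomialCoextDiff_surjective {S : Type u} [CommRing S] (N : ModuleCat.{u} S[X]) :
    Function.Surjective (polynomialCoextDiff N) := by
  intro h
  -- The equation forces `g (X ^ (i + 1)) = X • g (X ^ i) + h (X ^ i)`; the free choice `g 1 = 0`
  -- starts the recursion.
  let v : ℕ → N := fun i => Nat.rec (motive := fun _ => N) 0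
    (fun i x => (X : S[X]) • x + coextEval h (X ^ i)) i
  obtain ⟨g, hgs, hg⟩ : ∃ g : S[X] →+ N, (∀ r s, g (C r * s) = (C r : S[X]) • g s) ∧
      ∀ i, g (X ^ i) = v i := by
    let _ : Module S N := Module.compHom N (C : S →+* S[X])
    refine ⟨((basisMonomials S).constr S v).toAddMonoidHom, fun r s => ?_, fun i => ?_⟩
    · rw [← smul_eq_C_mul]
      exact ((basisMonomials S).constr S v).map_smul r s
    · have := (basisMonomials S).constr_basis S v i
      rw [coe_basisMonomials] at this
      beta_reduce at this
      rw [monomial_one_right_eq_X_pow] at this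
      exact this
  refine ⟨coextMk g hgs, coextEval_monomial fun i => ?_⟩
  rw [polynomialCoextDiff_apply, ← pow_succ', coextEval_mk, coextEval_mk, hg, hg]
  exact add_sub_cancel_left _ _

open Polynomial in
-- The sequence `0 → N → Hom_S(S[X], N) → Hom_S(S[X], N) → 0`, with first map `x ↦ (p ↦ p • x)` and
-- second map `polynomialCoextDiff`, is exact. The last two terms are coextended from `S`, so they
-- have injective dimension at most `n`, and the kernel gains at most one.
theorem hasInjectiveDimensionLE_polynomial {S : Type u} [CommRing S] (n : ℕ)
    (hS : ∀ N : ModuleCat.{u} S, HasInjectiveDimensionLE N n) (N : ModuleCat.{u} S[X]) :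
    HasInjectiveDimensionLE N (n + 1) := by
  have hp : Module.Projective S ((restrictScalars (C : S →+* S[X])).obj (of S[X] S[X])) :=
    Module.Projective.of_equiv (polynomialRestrictEquiv S)
  have hF := hasInjectiveDimensionLE_coextendScalars (C : S →+* S[X]) n _
    (hS ((restrictScalars C).obj N))
  let i : N →ₗ[S[X]] (coextendScalars (C : S →+* S[X])).obj ((restrictScalars C).obj N) :=
    RestrictionCoextensionAdj.app' C N
  have hi : ∀ (x : N) (p : S[X]), coextEval (i x) p = p • x := fun _ _ => rfl
  have w : polynomialCoextDiff N ∘ₗ i = 0 := by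
    refine LinearMap.ext fun x => coext_ext fun p => ?_
    rw [LinearMap.comp_apply, polynomialCoextDiff_apply, hi, hi, mul_smul, sub_self]
    rfl
  have hT : (shortComplexOfCompEqZero i (polynomialCoextDiff N) w).ShortExact := by
    refine shortComplex_shortExact _ ?_ ?_ (polynomialCoextDiff_surjective N)
    · intro (g : (coextendScalars (C : S →+* S[X])).obj ((restrictScalars C).obj N))
      constructor
      · intro (hg : polynomialCoextDiff N g = 0)
        have hg' : ∀ p : S[X], coextEval g (X * p) = (X : S[X]) • coextEval g p := fun p =>
          sub_eq_zero.1 (by rw [← polynomialCoextDiff_apply, hg]; rfl)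
        refine ⟨coextEval g 1, coextEval_monomial fun j => ?_⟩
        refine (hi (coextEval g 1) (X ^ j)).trans ?_
        induction j with
        | zero => rw [pow_zero, one_smul]
        | succ j ih => rw [pow_succ', hg', mul_smul, ih]
      · rintro ⟨x, rfl⟩
        exact LinearMap.congr_fun w x
    · intro (x : N) (y : N) (e : i x = i y)
      rw [← one_smul S[X] x, ← hi, e, hi, one_smul]
  have hF2 : HasInjectiveDimensionLT
      (shortComplexOfCompEqZero i (polynomialCoextDiff N) w).X₂ (n + 1 + 1) :=
    have : HasInjectiveDimensionLT
      (shortComplexOfCompEqZero i (polynomialCoextDiff N) w).X₂ (n + 1) := hF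
    hasInjectiveDimensionLT_of_ge _ (n + 1) _ (by omega)
  exact hT.hasInjectiveDimensionLT_X₁ (n + 1) hF hF2

theorem hasInjectiveDimensionLE_of_ringEquiv {R R' : Type u} [Ring R] [Ring R'] (e : R ≃+* R')
    (n : ℕ) (hR : ∀ N : ModuleCat.{u} R, HasInjectiveDimensionLE N n) (N : ModuleCat.{u} R') :
    HasInjectiveDimensionLE N n := by
  let := RingHomInvPair.of_ringEquiv e
  let := RingHomInvPair.of_ringEquiv e.symm
  refine (hasInjectiveDimensionLE_iff_of_semiLinearEquiv e
    (M := (restrictScalars (e : R →+* R')).obj N) (N := N)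
    { toFun := fun x => x, invFun := fun x => x, map_add' := fun _ _ => rfl,
      map_smul' := fun _ _ => rfl, left_inv := fun _ => rfl, right_inv := fun _ => rfl } n).1 (hR _)

/-- Hilbert's syzygy theorem in injective form: one more dimension for each variable, starting from
a field, over which every module is injective. -/
theorem hasInjectiveDimensionLE_mvPolynomial (k : Type u) [Field k] (n : ℕ)
    (N : ModuleCat.{u} (MvPolynomial (Fin n) k)) : HasInjectiveDimensionLE N n := by
  induction n with
  | zero =>
    refine hasInjectiveDimensionLE_of_ringEquiv
      (MvPolynomial.isEmptyRingEquiv k (Fin 0)).symm 0 (fun V => ?_) N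
    simp only [HasInjectiveDimensionLE, zero_add, ← injective_iff_hasInjectiveDimensionLT_one]
    have : Module.Injective k V := Module.injective_of_isSemisimpleRing k V
    exact Module.injective_object_of_injective_module k V
  | succ n ih =>
    exact hasInjectiveDimensionLE_of_ringEquiv
      (MvPolynomial.finSuccEquiv k n).symm.toRingEquiv (n + 1)
      (hasInjectiveDimensionLE_polynomial n ih) N

end ModuleCat

/-! ### Algebras that are free of rank four over a central polynomial ring -/

/-- `a * a`, `b * b` and `a * b + b * a` are the central scalars `α`, `β` and `γ` from `P`. -/
structure IsCliffordPair {P E : Type u} [CommRing P] [Ring E] (ψ : P →+* E) (a b : E)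
    (α β γ : P) : Prop where
  comm : ∀ p e, ψ p * e = e * ψ p
  left_sq : a * a = ψ α
  right_sq : b * b = ψ β
  anticomm : a * b + b * a = ψ γ

/-- A pair as in `IsCliffordPair` such that `E` is a free `P`-module with basis
`1, a, b, a * b`. -/
structure IsRankTwoClifford {P E : Type u} [CommRing P] [Ring E] (ψ : P →+* E) (a b : E)
    (α β γ : P) : Prop extends IsCliffordPair ψ a b α β γ where
  exists_coeff : ∀ e, ∃ c₀ c₁ c₂ c₃, e = ψ c₀ + ψ c₁ * a + ψ c₂ * b + ψ c₃ * (a * b)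
  coeff_eq_zero : ∀ c₀ c₁ c₂ c₃, ψ c₀ + ψ c₁ * a + ψ c₂ * b + ψ c₃ * (a * b) = 0 →
    c₀ = 0 ∧ c₁ = 0 ∧ c₂ = 0 ∧ c₃ = 0

namespace IsCliffordPair

variable {P E : Type u} [CommRing P] [Ring E] {ψ : P →+* E} {a b : E} {α β γ : P}

theorem commute (h : IsCliffordPair ψ a b α β γ) (p q : P) : Commute (ψ p) (ψ q) := h.comm p _

theorem op_coeff (h : IsCliffordPair ψ a b α β γ) (c₀ c₁ c₂ c₃ : P) :
    MulOpposite.op (ψ c₀ + ψ c₁ * a + ψ c₂ * b + ψ c₃ * (a * b)) =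
      ψ.toOpposite h.commute c₀ + ψ.toOpposite h.commute c₂ * MulOpposite.op b +
        ψ.toOpposite h.commute c₁ * MulOpposite.op a +
        ψ.toOpposite h.commute c₃ * (MulOpposite.op b * MulOpposite.op a) := by
  refine MulOpposite.unop_injective ?_
  change _ = ψ c₀ + b * ψ c₂ + a * ψ c₁ + a * b * ψ c₃
  rw [MulOpposite.unop_op, h.comm c₁, h.comm c₂, h.comm c₃]
  abel

theorem scalar_mul (a b : E) (p c₀ c₁ c₂ c₃ : P) :
    ψ p * (ψ c₀ + ψ c₁ * a + ψ c₂ * b + ψ c₃ * (a * b)) =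
      ψ (p * c₀) + ψ (p * c₁) * a + ψ (p * c₂) * b + ψ (p * c₃) * (a * b) := by
  simp only [mul_add, map_mul, mul_assoc]

variable (h : IsCliffordPair ψ a b α β γ)
include h

theorem left_comm (p : P) (e x : E) : e * (ψ p * x) = ψ p * (e * x) := by
  rw [← mul_assoc, ← h.comm, mul_assoc]

theorem left_mul (c₀ c₁ c₂ c₃ : P) :
    a * (ψ c₀ + ψ c₁ * a + ψ c₂ * b + ψ c₃ * (a * b)) =
      ψ (c₁ * α) + ψ c₀ * a + ψ (c₃ * α) * b + ψ c₂ * (a * b) := by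
  simp only [mul_add, h.left_comm _ a, ← h.comm c₀ a, map_mul, mul_assoc, ← h.left_sq]
  abel

theorem right_mul (c₀ c₁ c₂ c₃ : P) :
    b * (ψ c₀ + ψ c₁ * a + ψ c₂ * b + ψ c₃ * (a * b)) =
      ψ (c₁ * γ + c₂ * β) + ψ (-(c₃ * β)) * a + ψ (c₀ + c₃ * γ) * b + ψ (-c₁) * (a * b) := by
  have e1 : b * a = ψ γ - a * b := by rw [← h.anticomm]; abel
  have e2 : b * (a * b) = ψ γ * b - ψ β * a := by
    rw [← mul_assoc, e1, sub_mul, mul_assoc, h.right_sq, h.comm β]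
  simp only [mul_add, h.left_comm _ b, ← h.comm c₀ b, e1, e2, h.right_sq, map_add, map_neg, map_mul,
    mul_sub, add_mul, neg_mul, mul_assoc]
  abel

end IsCliffordPair

namespace IsRankTwoClifford

variable {P E : Type u} [CommRing P] [Ring E] {ψ : P →+* E} {a b : E} {α β γ : P}

/-- Reversing products turns `a * b` into `op b * op a`. Listing the pair in the order `op b`, `op
a` therefore keeps the basis, and exchanges `α` with `β`. -/
theorem op (h : IsRankTwoClifford ψ a b α β γ) :
    IsRankTwoClifford (ψ.toOpposite h.commute)
      (MulOpposite.op b) (MulOpposite.op a) β α γ where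
  comm p e := MulOpposite.unop_injective (h.comm p e.unop).symm
  left_sq := MulOpposite.unop_injective h.right_sq
  right_sq := MulOpposite.unop_injective h.left_sq
  anticomm := MulOpposite.unop_injective h.anticomm
  exists_coeff e := by
    obtain ⟨c₀, c₁, c₂, c₃, hc⟩ := h.exists_coeff e.unop
    refine ⟨c₀, c₂, c₁, c₃, ?_⟩
    rw [← h.op_coeff, ← hc, MulOpposite.op_unop]
  coeff_eq_zero c₀ c₁ c₂ c₃ hc := by
    have hc' : ψ c₀ + b * ψ c₁ + a * ψ c₂ + a * b * ψ c₃ = 0 := congrArg MulOpposite.unop hc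
    rw [← h.comm, ← h.comm, ← h.comm] at hc'
    obtain ⟨h0, h1, h2, h3⟩ := h.coeff_eq_zero c₀ c₂ c₁ c₃ (by rw [← hc']; abel)
    exact ⟨h0, h2, h1, h3⟩


variable (h : IsRankTwoClifford ψ a b α β γ)
include h

theorem coeff_unique {c₀ c₁ c₂ c₃ d₀ d₁ d₂ d₃ : P}
    (e : ψ c₀ + ψ c₁ * a + ψ c₂ * b + ψ c₃ * (a * b) =
      ψ d₀ + ψ d₁ * a + ψ d₂ * b + ψ d₃ * (a * b)) :
    c₀ = d₀ ∧ c₁ = d₁ ∧ c₂ = d₂ ∧ c₃ = d₃ := by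
  obtain ⟨h0, h1, h2, h3⟩ := h.coeff_eq_zero (c₀ - d₀) (c₁ - d₁) (c₂ - d₂) (c₃ - d₃) (by
    simp only [map_sub, sub_mul]
    rw [← sub_eq_zero.2 e]
    abel)
  exact ⟨sub_eq_zero.1 h0, sub_eq_zero.1 h1, sub_eq_zero.1 h2, sub_eq_zero.1 h3⟩

theorem nontrivial [Nontrivial P] : Nontrivial E := by
  refine ⟨1, 0, fun h1 => one_ne_zero (α := P) (h.coeff_eq_zero 1 0 0 0 ?_).1⟩
  simpa using h1

theorem projective_restrictScalars :
    Module.Projective P ((ModuleCat.restrictScalars ψ).obj (ModuleCat.of E E)) := by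
  let f : (P × P × P × P) →ₗ[P] (ModuleCat.restrictScalars ψ).obj (ModuleCat.of E E) :=
    { toFun := fun c => (ψ c.1 + ψ c.2.1 * a + ψ c.2.2.1 * b + ψ c.2.2.2 * (a * b) : E)
      map_add' := fun c d => by
        change ψ (c.1 + d.1) + ψ (c.2.1 + d.2.1) * a + ψ (c.2.2.1 + d.2.2.1) * b +
            ψ (c.2.2.2 + d.2.2.2) * (a * b) =
          ((ψ c.1 + ψ c.2.1 * a + ψ c.2.2.1 * b + ψ c.2.2.2 * (a * b)) +
            (ψ d.1 + ψ d.2.1 * a + ψ d.2.2.1 * b + ψ d.2.2.2 * (a * b)) : E)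
        simp only [map_add, add_mul]
        abel
      map_smul' := fun p c => (IsCliffordPair.scalar_mul a b p _ _ _ _).symm }
  refine Module.Projective.of_equiv (LinearEquiv.ofBijective f ⟨fun c d e => ?_, fun e => ?_⟩)
  · obtain ⟨h0, h1, h2, h3⟩ := h.coeff_unique e
    exact Prod.ext h0 (Prod.ext h1 (Prod.ext h2 h3))
  · obtain ⟨c₀, c₁, c₂, c₃, hc⟩ := h.exists_coeff e
    exact ⟨(c₀, c₁, c₂, c₃), hc.symm⟩

/-- The coefficient of `a * b`, as a `P`-linear form. -/
theorem exists_form : ∃ t : E →+ P, (∀ p e, t (ψ p * e) = p * t e) ∧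
    ∀ c₀ c₁ c₂ c₃, t (ψ c₀ + ψ c₁ * a + ψ c₂ * b + ψ c₃ * (a * b)) = c₃ := by
  choose c₀ c₁ c₂ c₃ hc using h.exists_coeff
  have key : ∀ d₀ d₁ d₂ d₃, c₃ (ψ d₀ + ψ d₁ * a + ψ d₂ * b + ψ d₃ * (a * b)) = d₃ :=
    fun d₀ d₁ d₂ d₃ => (h.coeff_unique (hc _)).2.2.2.symm
  refine ⟨AddMonoidHom.mk' c₃ fun x y => ?_, fun p e => ?_, key⟩
  · rw [← key (c₀ x + c₀ y) (c₁ x + c₁ y) (c₂ x + c₂ y) (c₃ x + c₃ y)]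
    congr 1
    conv_lhs => rw [hc x, hc y]
    simp only [map_add, add_mul]
    abel
  · change c₃ (ψ p * e) = p * c₃ e
    conv_lhs => rw [hc e, IsCliffordPair.scalar_mul, key]

open ModuleCat in
/-- `E` is a Frobenius extension of `P`, hence coinduced from it. -/
theorem nonempty_linearEquiv_coextendScalars :
    Nonempty (ModuleCat.of E E ≅ (coextendScalars ψ).obj (ModuleCat.of P P)) := by
  obtain ⟨t, ht, tc⟩ := h.exists_form
  -- With `tc`, these pair `1, a, b, a * b` with an element in terms of its coefficients. The matrix
  -- of the pairing is antidiagonal with entries `±1`, apart from one further corner entry `γ`, so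
  -- it is invertible over `P`.
  have t1 : ∀ c₀ c₁ c₂ c₃, t (a * (ψ c₀ + ψ c₁ * a + ψ c₂ * b + ψ c₃ * (a * b))) = c₂ :=
    fun c₀ c₁ c₂ c₃ => by rw [h.left_mul, tc]
  have t2 : ∀ c₀ c₁ c₂ c₃, t (b * (ψ c₀ + ψ c₁ * a + ψ c₂ * b + ψ c₃ * (a * b))) = -c₁ :=
    fun c₀ c₁ c₂ c₃ => by rw [h.right_mul, tc]
  have t3 : ∀ c₀ c₁ c₂ c₃,
      t (a * b * (ψ c₀ + ψ c₁ * a + ψ c₂ * b + ψ c₃ * (a * b))) = c₀ + c₃ * γ :=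
    fun c₀ c₁ c₂ c₃ => by rw [mul_assoc, h.right_mul, t1]
  let F : E →ₗ[E] (coextendScalars ψ).obj (ModuleCat.of P P) :=
    { toFun := fun e => (CoextendScalars.equiv ψ (ModuleCat.of P P)).symm
        { toFun := fun s : E => t (s * e)
          map_add' := fun s s' => (congrArg t (add_mul (R := E) s s' e)).trans (map_add t _ _)
          map_smul' := fun p s => (congrArg t (mul_assoc (G := E) (ψ p) s e)).trans (ht p _) }
      map_add' := fun x y => CoextendScalars.ext (LinearMap.ext fun s : E =>
        (congrArg t (mul_add s x y)).trans (map_add t _ _))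
      map_smul' := fun e x => CoextendScalars.ext (LinearMap.ext fun s : E =>
        congrArg t (mul_assoc s e x).symm) }
  have hF : ∀ e s : E, CoextendScalars.equiv ψ (ModuleCat.of P P) (F e) s = t (s * e) :=
    fun _ _ => rfl
  refine ⟨(LinearEquiv.ofBijective F ⟨?_, fun g => ?_⟩).toModuleIso⟩
  · rw [injective_iff_map_eq_zero]
    intro e he
    have z : ∀ s : E, t (s * e) = 0 := fun s => by rw [← hF, he]; rfl
    obtain ⟨c₀, c₁, c₂, c₃, rfl⟩ := h.exists_coeff e
    have z0 := z 1
    have z1 := z a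
    have z2 := z b
    have z3 := z (a * b)
    rw [one_mul, tc] at z0
    rw [t1] at z1
    rw [t2, neg_eq_zero] at z2
    rw [t3, z0, zero_mul, add_zero] at z3
    simp [z0, z1, z2, z3]
  · let G : E → P := fun s => CoextendScalars.equiv ψ (ModuleCat.of P P) g s
    have Ga : ∀ s s', G (s + s') = G s + G s' := fun s s' =>
      (CoextendScalars.equiv ψ (ModuleCat.of P P) g).map_add s s'
    have Gs : ∀ p s, G (ψ p * s) = p * G s := fun p s =>
      (CoextendScalars.equiv ψ (ModuleCat.of P P) g).map_smul p s
    -- The coefficients solve `c₃ = G 1`, `c₂ = G a`, `-c₁ = G b` and `c₀ + c₃ * γ = G (a * b)`.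
    refine ⟨ψ (G (a * b) - G 1 * γ) + ψ (-G b) * a + ψ (G a) * b + ψ (G 1) * (a * b), ?_⟩
    refine CoextendScalars.ext (LinearMap.ext fun s : E => ?_)
    refine (hF _ s).trans (?_ : _ = G s)
    obtain ⟨d₀, d₁, d₂, d₃, rfl⟩ := h.exists_coeff s
    have G0 : G (ψ d₀) = d₀ * G 1 := by rw [← Gs, mul_one]
    rw [Ga, Ga, Ga, G0, Gs, Gs, Gs, add_mul, add_mul, add_mul, map_add, map_add, map_add,
      mul_assoc (ψ d₁), mul_assoc (ψ d₂), mul_assoc (ψ d₃), ht, ht, ht, ht, tc, t1, t2, t3]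
    ring

theorem hasInjectiveDimensionLE {n : ℕ} (hP : HasInjectiveDimensionLE (ModuleCat.of P P) n) :
    HasInjectiveDimensionLE (ModuleCat.of E E) n := by
  have := h.projective_restrictScalars
  obtain ⟨i⟩ := h.nonempty_linearEquiv_coextendScalars
  have := ModuleCat.hasInjectiveDimensionLE_coextendScalars ψ n _ hP
  exact hasInjectiveDimensionLT_of_iso i.symm (n + 1)

end IsRankTwoClifford

/-! ### Dimension shifting for `Ext` -/

section Linear

variable {k : Type u} [Field k] {R : Type u} [Ring R] [Algebra k R]

/-- `Ext` is invariant under isomorphisms. -/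
noncomputable def extLinearEquivOfIso {K K' Y Y' : ModuleCat.{u} R} (i : K ≅ K') (j : Y ≅ Y')
    (n : ℕ) : Abelian.Ext.{u} K Y n ≃ₗ[k] Abelian.Ext.{u} K' Y' n :=
  LinearEquiv.ofLinearMap
    (Abelian.Ext.precompOfLinear (Abelian.Ext.mk₀ i.inv) k Y' (zero_add n) ∘ₗ
      Abelian.Ext.postcompOfLinear (Abelian.Ext.mk₀ j.hom) k K (add_zero n))
    (Abelian.Ext.precompOfLinear (Abelian.Ext.mk₀ i.hom) k Y (zero_add n) ∘ₗ
      Abelian.Ext.postcompOfLinear (Abelian.Ext.mk₀ j.inv) k K' (add_zero n))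
    (by
      ext x
      simp [← Abelian.Ext.comp_assoc_of_second_deg_zero, Abelian.Ext.comp_assoc_of_third_deg_zero])
    (by
      ext x
      simp [← Abelian.Ext.comp_assoc_of_second_deg_zero, Abelian.Ext.comp_assoc_of_third_deg_zero])

/-- If the endomorphism `f` of `N` with cokernel `Q` acts by zero on `Ext(K, N)`, the connecting
map `Extⁿ(K, Q) → Extⁿ⁺¹(K, N)` is bijective when `Extⁿ(K, N) = 0`. -/
theorem nonempty_ext_linearEquiv_succ {K : ModuleCat.{u} R} {S : ShortComplex (ModuleCat.{u} R)}
    (hS : S.ShortExact) {n : ℕ}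
    (hf : ∀ x : Abelian.Ext.{u} K S.X₁ (n + 1), x.comp (Abelian.Ext.mk₀ S.f) (add_zero _) = 0)
    (h0 : Subsingleton (Abelian.Ext.{u} K S.X₂ n)) :
    Nonempty (Abelian.Ext.{u} K S.X₃ n ≃ₗ[k] Abelian.Ext.{u} K S.X₁ (n + 1)) := by
  refine ⟨LinearEquiv.ofBijective
    (Abelian.Ext.postcompOfLinear hS.extClass k K (rfl : n + 1 = n + 1)) ⟨?_, fun y => ?_⟩⟩
  · rw [injective_iff_map_eq_zero]
    intro x hx
    obtain ⟨y, rfl⟩ := Abelian.Ext.covariant_sequence_exact₃ K hS x rfl hx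
    rw [Subsingleton.elim y 0, Abelian.Ext.zero_comp]
  · exact Abelian.Ext.covariant_sequence_exact₁ K hS y (hf y) rfl

theorem rank_directSum_ext_eq_one {K Y : ModuleCat.{u} R} (m : ℕ)
    (h0 : ∀ n, n ≠ m → Subsingleton (Abelian.Ext.{u} K Y n))
    (hm : Nonempty (Abelian.Ext.{u} K Y m ≃ₗ[k] k)) :
    Module.rank k (⨁ i : ℕ, Abelian.Ext.{u} K Y i) = 1 := by
  classical
  obtain ⟨e⟩ := hm
  have hb : Function.Bijective (DirectSum.lof k ℕ (fun i => Abelian.Ext.{u} K Y i) m) := by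
    refine ⟨DirectSum.of_injective m, fun x => ?_⟩
    refine ⟨x m, ?_⟩
    ext i
    by_cases hi : i = m
    · subst hi
      rw [DirectSum.lof_apply]
    · have := h0 i hi
      exact Subsingleton.elim _ _
  rw [← (LinearEquiv.ofBijective _ hb).rank_eq, e.rank_eq, Module.rank_self]

theorem ExtOneInjFinite.of_linearEquiv {A A' : Type u} [AddCommGroup A] [Module R A]
    [AddCommGroup A'] [Module R A'] (e : A ≃ₗ[R] A') {S : Set A}
    (h : ExtOneInjFinite k R A S) : ExtOneInjFinite k R A' (e '' S) := by
  obtain ⟨h1, h2⟩ := h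
  have q : (A ⧸ Submodule.span R S) ≃ₗ[R] A' ⧸ Submodule.span R (e '' S) :=
    Submodule.Quotient.equiv _ _ e (Submodule.map_span e.toLinearMap S)
  refine ⟨?_, ?_⟩
  · rw [← h1]
    refine (LinearEquiv.rank_eq (DFinsupp.mapRange.linearEquiv fun i => ?_)).symm
    exact extLinearEquivOfIso q.toModuleIso e.toModuleIso i
  · rwa [← injectiveDimension_eq_of_iso e.toModuleIso]

end Linear

section Central

variable {R : Type u} [Ring R]

/-- Multiplication by a central element. -/
def centralMul (s : R) (hs : ∀ r, s * r = r * s) (N : Type u) [AddCommGroup N] [Module R N] :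
    N →ₗ[R] N where
  toFun x := s • x
  map_add' := smul_add s
  map_smul' r x := by rw [RingHom.id_apply, ← mul_smul, ← mul_smul, hs]

open scoped ModuleCat.Algebra in
-- The centre of `R` acts on `Ext(K, N)` in the same way through `K` as through `N`, and `s` is zero
-- on `K`.
theorem ext_comp_centralMul {s : R} (hs : ∀ r, s * r = r * s) {K N : ModuleCat.{u} R}
    (hK : ∀ x : K, s • x = 0) {n : ℕ} (x : Abelian.Ext.{u} K N n) :
    x.comp (Abelian.Ext.mk₀ (ModuleCat.ofHom (centralMul s hs N))) (add_zero n) = 0 := by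
  let c : Subring.center R := ⟨s, Subring.mem_center_iff.2 fun r => (hs r).symm⟩
  have e1 : ModuleCat.ofHom (centralMul s hs N) = c • 𝟙 N := by
    ext y
    rfl
  have e2 : c • 𝟙 K = 0 := by
    ext y
    exact hK y
  rw [e1, ← Abelian.Ext.smul_eq_comp_mk₀]
  calc c • x = c • (Abelian.Ext.mk₀ (𝟙 K)).comp x (zero_add n) := by rw [Abelian.Ext.mk₀_id_comp]
    _ = (Abelian.Ext.mk₀ (c • 𝟙 K)).comp x (zero_add n) := by
      rw [Abelian.Ext.mk₀_smul, Abelian.Ext.smul_comp]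
    _ = 0 := by rw [e2, Abelian.Ext.mk₀_zero, Abelian.Ext.zero_comp]

theorem subsingleton_ext_zero {s : R} (hs : ∀ r, s * r = r * s) {K N : ModuleCat.{u} R}
    (hK : ∀ x : K, s • x = 0) (hN : Function.Injective (centralMul s hs N)) :
    Subsingleton (Abelian.Ext.{u} K N 0) := by
  refine Abelian.Ext.homEquiv₀.subsingleton_congr.2 ⟨fun f g => ?_⟩
  have key : ∀ f : K ⟶ N, f = 0 := fun f => by
    ext x
    apply hN
    change s • f x = s • (0 : N)
    rw [← map_smul, hK, map_zero, smul_zero]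
  rw [key f, key g]

/-- The quotient of a module by the image of a central element. -/
abbrev CentralQuotient (s : R) (hs : ∀ r, s * r = r * s) (N : Type u) [AddCommGroup N]
    [Module R N] : Type u := N ⧸ LinearMap.range (centralMul s hs N)

/-- Rees's dimension shift, from the long exact sequence of `0 → N → N → N/sN → 0`, where
multiplication by `s` induces zero on `Ext(K, N)`. -/
theorem nonempty_ext_centralQuotient {k : Type u} [Field k] [Algebra k R] {s : R}
    (hs : ∀ r, s * r = r * s)
    {K : ModuleCat.{u} R} (hK : ∀ x : K, s • x = 0) (N : Type u) [AddCommGroup N] [Module R N]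
    (hN : Function.Injective (centralMul s hs N)) (n : ℕ)
    (h0 : Subsingleton (Abelian.Ext.{u} K (ModuleCat.of R N) n)) :
    Nonempty (Abelian.Ext.{u} K (ModuleCat.of R (CentralQuotient s hs N)) n ≃ₗ[k]
      Abelian.Ext.{u} K (ModuleCat.of R N) (n + 1)) := by
  let S := ModuleCat.shortComplexOfCompEqZero _ _
    (centralMul s hs N).exact_map_mkQ_range.linearMap_comp_eq_zero
  have hS : S.ShortExact := ModuleCat.shortComplex_shortExact S
    (centralMul s hs N).exact_map_mkQ_range hN (Submodule.mkQ_surjective _)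
  exact nonempty_ext_linearEquiv_succ hS (fun x => ext_comp_centralMul hs hK x) h0

end Central

/-! ### Rank four algebras over the polynomial ring in two variables -/

theorem MvPolynomial.exists_eq_of_constantCoeff_eq_zero {k : Type u} [Field k]
    {p : MvPolynomial (Fin 2) k} (hp : constantCoeff p = 0) :
    ∃ u v, p = X 0 * u + X 1 * v := by
  have key : ∀ p : MvPolynomial (Fin 2) k, ∃ u v, p = C (constantCoeff p) + (X 0 * u + X 1 * v) := by
    intro p
    induction p using MvPolynomial.induction_on with
    | C a => exact ⟨0, 0, by simp⟩
    | add p q hp hq =>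
      obtain ⟨u, v, e⟩ := hp
      obtain ⟨u', v', e'⟩ := hq
      refine ⟨u + u', v + v', ?_⟩
      conv_lhs => rw [e, e']
      rw [map_add, map_add]
      ring
    | mul_X p i _ =>
      fin_cases i
      · exact ⟨p, 0, by simp [mul_comm]⟩
      · exact ⟨0, p, by simp [mul_comm]⟩
  obtain ⟨u, v, e⟩ := key p
  exact ⟨u, v, by rw [e, hp, map_zero, zero_add]⟩

/-- A map out of a cyclic module is determined by its value at the generator, so `Hom(K, Q)` is the
line spanned by `g`. -/
theorem nonempty_ext_zero_linearEquiv_of_cyclic {k R : Type u} [Field k] [Ring R] [Algebra k R]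
    {K Q : ModuleCat.{u} R} (g : K ⟶ Q) (x : K) (hx : ∀ y : K, ∃ r : R, y = r • x)
    (hg : g.hom x ≠ 0) (hf : ∀ f : K ⟶ Q, ∃ c : k, f.hom x = algebraMap k R c • g.hom x) :
    Nonempty (Abelian.Ext.{u} K Q 0 ≃ₗ[k] k) := by
  have hs : ∀ c : k, (LinearMap.toSpanSingleton k (K ⟶ Q) g c).hom x =
      algebraMap k R c • g.hom x := fun _ => rfl
  refine ⟨Abelian.Ext.linearEquiv₀.trans
    (LinearEquiv.ofBijective (LinearMap.toSpanSingleton k (K ⟶ Q) g) ⟨?_, fun f => ?_⟩).symm⟩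
  · refine LinearMap.ker_eq_bot.1 (LinearMap.ker_toSpanSingleton k fun h0 => hg ?_)
    rw [h0]
    rfl
  · obtain ⟨c, hc⟩ := hf f
    refine ⟨c, ?_⟩
    ext y
    obtain ⟨r, rfl⟩ := hx y
    rw [map_smul, map_smul]
    exact congrArg (r • ·) ((hs c).trans hc.symm)

namespace IsRankTwoClifford

open MvPolynomial

variable {k E : Type u} [Field k] [Ring E] {ψ : MvPolynomial (Fin 2) k →+* E}
  {a b : E} {α β γ : MvPolynomial (Fin 2) k}

/-- The last three terms are left multiples of `a` or `b`, so only the constant term of `c₀` is an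
obstruction. -/
theorem mem_span_of_constantCoeff_eq_zero {c₀ : MvPolynomial (Fin 2) k}
    (h0 : constantCoeff c₀ = 0) (c₁ c₂ c₃ : MvPolynomial (Fin 2) k) :
    ψ c₀ + ψ c₁ * a + ψ c₂ * b + ψ c₃ * (a * b) ∈
      Submodule.span E {a, b, ψ (X 0), ψ (X 1)} := by
  obtain ⟨u, v, rfl⟩ := exists_eq_of_constantCoeff_eq_zero h0
  have mul : ∀ e y : E, y ∈ ({a, b, ψ (X 0), ψ (X 1)} : Set E) →
      e * y ∈ Submodule.span E {a, b, ψ (X 0), ψ (X 1)} := fun e y hy =>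
    Submodule.smul_mem _ e (Submodule.subset_span hy)
  rw [mul_comm (X 0) u, mul_comm (X 1) v, map_add, map_mul, map_mul, ← mul_assoc]
  exact add_mem (add_mem (add_mem (add_mem (mul _ _ (by simp)) (mul _ _ (by simp)))
    (mul _ _ (by simp))) (mul _ _ (by simp))) (mul _ _ (by simp))

variable (h : IsRankTwoClifford ψ a b α β γ)
include h

theorem centralMul_X_zero_injective :
    Function.Injective (centralMul (ψ (X 0)) (h.comm _) E) := by
  rw [injective_iff_map_eq_zero]
  intro e he
  obtain ⟨c₀, c₁, c₂, c₃, rfl⟩ := h.exists_coeff e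
  have he' := (IsCliffordPair.scalar_mul a b (X 0) c₀ c₁ c₂ c₃).symm.trans he
  obtain ⟨h0, h1, h2, h3⟩ := h.coeff_eq_zero _ _ _ _ he'
  have z : ∀ p : MvPolynomial (Fin 2) k, X 0 * p = 0 → p = 0 := fun p hp =>
    (mul_eq_zero.1 hp).resolve_left (X_ne_zero 0)
  rw [z _ h0, z _ h1, z _ h2, z _ h3]
  simp

/-- With `centralMul_X_zero_injective`, this makes `X 0, X 1` a regular sequence on `E`.
Coefficientwise, the prime `X 0` divides `X 1 * p` but not `X 1`, hence divides `p`. -/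
theorem centralMul_X_one_injective :
    Function.Injective (centralMul (ψ (X 1)) (h.comm _)
      (CentralQuotient (ψ (X 0)) (h.comm _) E)) := by
  rw [injective_iff_map_eq_zero]
  intro x hx
  obtain ⟨e, rfl⟩ := Submodule.mkQ_surjective _ x
  have hx' : ψ (X 1) * e ∈ LinearMap.range (centralMul (ψ (X 0)) (h.comm _) E) :=
    (Submodule.Quotient.mk_eq_zero _).1 hx
  obtain ⟨f, hf⟩ := hx'
  obtain ⟨c₀, c₁, c₂, c₃, rfl⟩ := h.exists_coeff e
  obtain ⟨d₀, d₁, d₂, d₃, rfl⟩ := h.exists_coeff f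
  obtain ⟨h0, h1, h2, h3⟩ := h.coeff_unique
    ((IsCliffordPair.scalar_mul a b (X 0) _ _ _ _).symm.trans (hf.trans (IsCliffordPair.scalar_mul a b (X 1) _ _ _ _)))
  have z : ∀ p q : MvPolynomial (Fin 2) k, X 0 * q = X 1 * p → ∃ r, p = X 0 * r := by
    intro p q e
    have hd : (X 0 : MvPolynomial (Fin 2) k) ∣ X 1 * p := ⟨q, e.symm⟩
    refine ((X_prime (R := k) (i := (0 : Fin 2))).dvd_or_dvd hd).resolve_left fun h01 => ?_
    simp [X_dvd_X] at h01
  obtain ⟨r₀, rfl⟩ := z _ _ h0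
  obtain ⟨r₁, rfl⟩ := z _ _ h1
  obtain ⟨r₂, rfl⟩ := z _ _ h2
  obtain ⟨r₃, rfl⟩ := z _ _ h3
  refine (Submodule.Quotient.mk_eq_zero _).2 ⟨ψ r₀ + ψ r₁ * a + ψ r₂ * b + ψ r₃ * (a * b), ?_⟩
  exact IsCliffordPair.scalar_mul a b (X 0) _ _ _ _

/-- The submodule generated by `ψ (X 0)` and `ψ (X 1)`, as the kernel of
`E → E / X 0 → (E / X 0) / X 1`. -/
theorem mkQ_mkQ_eq_zero_iff (c₀ c₁ c₂ c₃ : MvPolynomial (Fin 2) k) :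
    (LinearMap.range (centralMul (ψ (X 1)) (h.comm _)
      (CentralQuotient (ψ (X 0)) (h.comm _) E))).mkQ
        ((LinearMap.range (centralMul (ψ (X 0)) (h.comm _) E)).mkQ
          (ψ c₀ + ψ c₁ * a + ψ c₂ * b + ψ c₃ * (a * b))) = 0 ↔
    constantCoeff c₀ = 0 ∧ constantCoeff c₁ = 0 ∧ constantCoeff c₂ = 0 ∧ constantCoeff c₃ = 0 := by
  rw [Submodule.mkQ_apply, Submodule.Quotient.mk_eq_zero]
  constructor
  · rintro ⟨x, hx⟩
    obtain ⟨f, rfl⟩ := Submodule.mkQ_surjective _ x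
    have hx' : ψ (X 1) * f - (ψ c₀ + ψ c₁ * a + ψ c₂ * b + ψ c₃ * (a * b)) ∈
        LinearMap.range (centralMul (ψ (X 0)) (h.comm _) E) := (Submodule.Quotient.eq _).1 hx
    obtain ⟨g, hg⟩ := hx'
    obtain ⟨d₀, d₁, d₂, d₃, rfl⟩ := h.exists_coeff f
    obtain ⟨e₀, e₁, e₂, e₃, rfl⟩ := h.exists_coeff g
    have hg' : ψ (X 0 * e₀ + c₀) + ψ (X 0 * e₁ + c₁) * a + ψ (X 0 * e₂ + c₂) * b +
        ψ (X 0 * e₃ + c₃) * (a * b) = ψ (X 1 * d₀) + ψ (X 1 * d₁) * a + ψ (X 1 * d₂) * b +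
        ψ (X 1 * d₃) * (a * b) := by
      rw [← IsCliffordPair.scalar_mul, ← sub_add_cancel (ψ (X 1) * _)
        (ψ c₀ + ψ c₁ * a + ψ c₂ * b + ψ c₃ * (a * b)), ← hg]
      change _ = ψ (X 0) * _ + _
      rw [IsCliffordPair.scalar_mul]
      simp only [map_add, add_mul]
      abel
    obtain ⟨h0, h1, h2, h3⟩ := h.coeff_unique hg'
    have z : ∀ p q r : MvPolynomial (Fin 2) k, X 0 * q + p = X 1 * r → constantCoeff p = 0 :=
      fun p q r e => by simpa using congrArg constantCoeff e
    exact ⟨z _ _ _ h0, z _ _ _ h1, z _ _ _ h2, z _ _ _ h3⟩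
  · rintro ⟨h0, h1, h2, h3⟩
    obtain ⟨u₀, v₀, rfl⟩ := exists_eq_of_constantCoeff_eq_zero h0
    obtain ⟨u₁, v₁, rfl⟩ := exists_eq_of_constantCoeff_eq_zero h1
    obtain ⟨u₂, v₂, rfl⟩ := exists_eq_of_constantCoeff_eq_zero h2
    obtain ⟨u₃, v₃, rfl⟩ := exists_eq_of_constantCoeff_eq_zero h3
    refine ⟨Submodule.mkQ _ (ψ v₀ + ψ v₁ * a + ψ v₂ * b + ψ v₃ * (a * b)), ?_⟩
    refine (Submodule.Quotient.eq _).2 ⟨-(ψ u₀ + ψ u₁ * a + ψ u₂ * b + ψ u₃ * (a * b)), ?_⟩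
    change ψ (X 0) * -_ = ψ (X 1) * _ - _
    rw [mul_neg, IsCliffordPair.scalar_mul, IsCliffordPair.scalar_mul]
    simp only [map_add, add_mul]
    abel

/-- Modulo both variables, `E` becomes the exterior algebra over `k` on `a` and `b`. A map from the
trivial module selects an element of its socle, which is spanned by the class of `a * b`. -/
theorem nonempty_ext_zero_linearEquiv [Algebra k E] (hψ : ∀ c, ψ (C c) = algebraMap k E c)
    (hα : constantCoeff α = 0) (hβ : constantCoeff β = 0) (hγ : constantCoeff γ = 0)
    {S : Set E} (hS : Submodule.span E S = Submodule.span E {a, b, ψ (X 0), ψ (X 1)}) :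
    Nonempty (Abelian.Ext.{u} (ModuleCat.of E (E ⧸ Submodule.span E S))
      (ModuleCat.of E (CentralQuotient (ψ (X 1)) (h.comm _)
        (CentralQuotient (ψ (X 0)) (h.comm _) E))) 0 ≃ₗ[k] k) := by
  let π : E →ₗ[E] CentralQuotient (ψ (X 1)) (h.comm _) (CentralQuotient (ψ (X 0)) (h.comm _) E) :=
    Submodule.mkQ _ ∘ₗ Submodule.mkQ _
  have hπ : ∀ c₀ c₁ c₂ c₃, π (ψ c₀ + ψ c₁ * a + ψ c₂ * b + ψ c₃ * (a * b)) = 0 ↔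
    constantCoeff c₀ = 0 ∧ constantCoeff c₁ = 0 ∧ constantCoeff c₂ = 0 ∧ constantCoeff c₃ = 0 :=
    h.mkQ_mkQ_eq_zero_iff
  have hπs : Function.Surjective π :=
    (Submodule.mkQ_surjective _).comp (Submodule.mkQ_surjective _)
  have eab : a * b = ψ 0 + ψ 0 * a + ψ 0 * b + ψ 1 * (a * b) := by simp
  -- The class of `a * b` lies in the socle: the products of `a` and `b` with it have coefficients
  -- that are multiples of `α`, `β` or `γ`, which vanish modulo the variables.
  have hle : Submodule.span E S ≤ LinearMap.ker (LinearMap.toSpanSingleton E _ (π (a * b))) := by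
    rw [hS, Submodule.span_le]
    have key : ∀ e : E, π (e * (a * b)) = 0 →
        e ∈ LinearMap.ker (LinearMap.toSpanSingleton E _ (π (a * b))) := fun e he => by
      rw [LinearMap.mem_ker, LinearMap.toSpanSingleton_apply, ← map_smul]
      exact he
    rintro e (rfl | rfl | rfl | rfl)
    · refine key _ ?_
      rw [eab, h.left_mul, hπ]
      simp [hα]
    · refine key _ ?_
      rw [eab, h.right_mul, hπ]
      simp [hβ, hγ]
    · refine key _ ?_
      rw [eab, IsCliffordPair.scalar_mul, hπ]
      simp
    · refine key _ ?_
      rw [eab, IsCliffordPair.scalar_mul, hπ]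
      simp
  let g : ModuleCat.of E (E ⧸ Submodule.span E S) ⟶
      ModuleCat.of E (CentralQuotient (ψ (X 1)) (h.comm _)
        (CentralQuotient (ψ (X 0)) (h.comm _) E)) :=
    ModuleCat.ofHom (Submodule.liftQ _ _ hle)
  have hg : g.hom (Submodule.Quotient.mk 1) = π (a * b) := by
    change LinearMap.toSpanSingleton E (CentralQuotient (ψ (X 1)) (h.comm _)
      (CentralQuotient (ψ (X 0)) (h.comm _) E)) (π (a * b)) 1 = _
    rw [LinearMap.toSpanSingleton_apply, one_smul]
  refine nonempty_ext_zero_linearEquiv_of_cyclic g (Submodule.Quotient.mk 1) (fun x => ?_) ?_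
    fun f => ?_
  · obtain ⟨e, rfl⟩ := Submodule.mkQ_surjective _ x
    refine ⟨e, ?_⟩
    change _ = Submodule.Quotient.mk (e * 1)
    rw [mul_one]
    rfl
  · rw [hg, eab, Ne, hπ]
    simp
  · obtain ⟨e, he⟩ := hπs (f.hom (Submodule.Quotient.mk 1))
    have kill : ∀ x ∈ Submodule.span E S, π (x * e) = 0 := fun x hx => by
      have h1 : π (x * e) = x • π e := π.map_smul x e
      rw [h1, he, ← map_smul]
      have h2 : x • (Submodule.Quotient.mk 1 : E ⧸ Submodule.span E S) = 0 := by
        rw [← Submodule.Quotient.mk_smul, smul_eq_mul, mul_one, Submodule.Quotient.mk_eq_zero]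
        exact hx
      exact (congrArg f.hom h2).trans (map_zero f.hom)
    obtain ⟨c₀, c₁, c₂, c₃, rfl⟩ := h.exists_coeff e
    -- Modulo the variables, `a * e = 0` forces the constant terms of `c₀` and `c₂` to vanish, and
    -- `b * e = 0` that of `c₁`; only the one of `c₃` survives.
    have ha := kill a (by rw [hS]; exact Submodule.subset_span (by simp))
    have hb := kill b (by rw [hS]; exact Submodule.subset_span (by simp))
    rw [h.left_mul, hπ] at ha
    rw [h.right_mul, hπ] at hb
    have h0 := ha.2.1
    have h2 := ha.2.2.2
    have h1 : constantCoeff c₁ = 0 := by simpa using hb.2.2.2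
    refine ⟨constantCoeff c₃, ?_⟩
    rw [hg, ← hψ, ← he, ← map_smul, smul_eq_mul, eq_comm]
    rw [← sub_eq_zero, ← map_sub]
    have e3 : ψ (C (constantCoeff c₃)) * (a * b) -
        (ψ c₀ + ψ c₁ * a + ψ c₂ * b + ψ c₃ * (a * b)) =
        ψ (-c₀) + ψ (-c₁) * a + ψ (-c₂) * b + ψ (C (constantCoeff c₃) - c₃) * (a * b) := by
      simp only [map_neg, map_sub, neg_mul, sub_mul]
      abel
    rw [e3, hπ]
    simp [h0, h1, h2]

/-- Shifting along `X 0` and then `X 1` moves `Ext²` with values in `E` to `Hom` into `E/(X 0, X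
1)E`, a line. Lower degrees vanish by regularity, and higher ones because the injective dimension is
at most `2`. -/
theorem extOneInjFinite [Algebra k E] (hψ : ∀ c, ψ (C c) = algebraMap k E c)
    (hα : constantCoeff α = 0) (hβ : constantCoeff β = 0) (hγ : constantCoeff γ = 0)
    {S : Set E} (hS : Submodule.span E S = Submodule.span E {a, b, ψ (X 0), ψ (X 1)}) :
    ExtOneInjFinite k E E S := by
  have hid : HasInjectiveDimensionLT (ModuleCat.of E E) (2 + 1) :=
    h.hasInjectiveDimensionLE (ModuleCat.hasInjectiveDimensionLE_mvPolynomial k 2 _)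
  have hkill : ∀ s ∈ Submodule.span E S, (∀ r, s * r = r * s) →
      ∀ x : ModuleCat.of E (E ⧸ Submodule.span E S), s • x = 0 := by
    intro s hs hc x
    obtain ⟨e, rfl⟩ := Submodule.mkQ_surjective _ x
    refine (Submodule.Quotient.mk_eq_zero _).2 ?_
    change s * e ∈ _
    rw [hc]
    exact Submodule.smul_mem _ e hs
  have k0 := hkill (ψ (X 0)) (by rw [hS]; exact Submodule.subset_span (by simp)) (h.comm _)
  have k1 := hkill (ψ (X 1)) (by rw [hS]; exact Submodule.subset_span (by simp)) (h.comm _)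
  have i0 := h.centralMul_X_zero_injective
  have i1 := h.centralMul_X_one_injective
  have s0 : Subsingleton (Abelian.Ext.{u} (ModuleCat.of E (E ⧸ Submodule.span E S))
      (ModuleCat.of E E) 0) := subsingleton_ext_zero (h.comm _) k0 i0
  have s1 : Subsingleton (Abelian.Ext.{u} (ModuleCat.of E (E ⧸ Submodule.span E S))
      (ModuleCat.of E (CentralQuotient (ψ (X 0)) (h.comm _) E)) 0) :=
    subsingleton_ext_zero (h.comm _) k1 i1
  obtain ⟨e1⟩ := nonempty_ext_centralQuotient (k := k) (h.comm _) k0 E i0 0 s0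
  have s2 : Subsingleton (Abelian.Ext.{u} (ModuleCat.of E (E ⧸ Submodule.span E S))
      (ModuleCat.of E E) 1) := e1.symm.toEquiv.subsingleton
  obtain ⟨e2⟩ := nonempty_ext_centralQuotient (k := k) (h.comm _) k0 E i0 1 s2
  obtain ⟨e3⟩ := nonempty_ext_centralQuotient (k := k) (h.comm _) k1 _ i1 0 s1
  obtain ⟨e4⟩ := h.nonempty_ext_zero_linearEquiv hψ hα hβ hγ hS
  refine ⟨rank_directSum_ext_eq_one 2 (fun n hn => ?_) ⟨e2.symm.trans (e3.symm.trans
    e4)⟩, ?_⟩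
  · match n with
    | 0 => exact s0
    | 1 => exact s2
    | 2 => exact absurd rfl hn
    | n + 3 => exact HasInjectiveDimensionLT.subsingleton _ 3 (n + 3) (by omega) _
  · refine lt_of_lt_of_le (injectiveDimension_lt_iff.2 hid) le_top

/-- Left and right modules over a rank two Clifford algebra over `k[X₀, X₁]`, with all the scalars
`α`, `β` and `γ` in the augmentation ideal. -/
theorem extOneInjFinite_and_op [Algebra k E] (hψ : ∀ c, ψ (C c) = algebraMap k E c)
    (hα : constantCoeff α = 0) (hβ : constantCoeff β = 0) (hγ : constantCoeff γ = 0)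
    {S : Set E} (hS : {a, b, ψ (X 0), ψ (X 1)} ⊆ S)
    (hS' : ∀ e ∈ S, ∃ c₀ c₁ c₂ c₃, constantCoeff c₀ = 0 ∧
      e = ψ c₀ + ψ c₁ * a + ψ c₂ * b + ψ c₃ * (a * b)) :
    ExtOneInjFinite k E E S ∧ ExtOneInjFinite k Eᵐᵒᵖ E S := by
  constructor
  · refine h.extOneInjFinite hψ hα hβ hγ (le_antisymm (Submodule.span_le.2 fun e he => ?_)
      (Submodule.span_mono hS))
    obtain ⟨c₀, c₁, c₂, c₃, h0, rfl⟩ := hS' e he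
    exact mem_span_of_constantCoeff_eq_zero h0 _ _ _
  · have hop : ExtOneInjFinite k Eᵐᵒᵖ Eᵐᵒᵖ (MulOpposite.op '' S) := by
      refine h.op.extOneInjFinite (fun c => congrArg MulOpposite.op (hψ c)) hβ hα hγ
        (le_antisymm (Submodule.span_le.2 ?_) (Submodule.span_mono ?_))
      · rintro _ ⟨e, he, rfl⟩
        obtain ⟨c₀, c₁, c₂, c₃, h0, rfl⟩ := hS' e he
        rw [h.op_coeff]
        exact mem_span_of_constantCoeff_eq_zero h0 _ _ _
      · rintro _ (rfl | rfl | rfl | rfl)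
        · exact ⟨b, hS (by simp), rfl⟩
        · exact ⟨a, hS (by simp), rfl⟩
        · exact ⟨ψ (X 0), hS (by simp), rfl⟩
        · exact ⟨ψ (X 1), hS (by simp), rfl⟩
    let u : Eᵐᵒᵖ ≃ₗ[Eᵐᵒᵖ] E :=
      { MulOpposite.opAddEquiv.symm with map_smul' := fun _ _ => rfl }
    have hu : u '' (MulOpposite.op '' S) = S := by
      rw [Set.image_image]
      exact Set.image_id S
    rw [← hu]
    exact hop.of_linearEquiv u

end IsRankTwoClifford

/-! ### The skew polynomial algebra over its central subalgebra of squares -/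

namespace SkewPoly

open MvPolynomial (C X constantCoeff)

variable {k : Type u} [Field k]

theorem left_induction {p : SkewPoly k → Prop} (algebraMap : ∀ r, p (algebraMap k _ r))
    (add : ∀ a b, p a → p b → p (a + b)) (smul : ∀ (c : k) a, p a → p (c • a))
    (x_mul : ∀ i a, p a → p (x k i * a)) (a : SkewPoly k) : p a := by
  have h : ∀ (n : ℕ) (a : SkewPoly k), a ∈ grading k n → p a := by
    intro n a ha
    induction ha using grading_induction with
    | algebraMap r => exact algebraMap r
    | add n a b _ _ _ iha ihb => exact add a b iha ihb
    | smul n c a _ _ iha => exact smul c a iha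
    | x_mul n i a _ _ iha => exact x_mul i a iha
  induction a using DirectSum.Decomposition.inductionOn (grading k) with
  | zero => simpa using algebraMap 0
  | homogeneous m => exact h _ _ m.2
  | add a b ha hb => exact add a b ha hb

/-- A skew derivation of degree `-1` with prescribed scalar values on the generators, as the upper
right entry of a homomorphism to upper triangular matrices. -/
def contractionHom (v : Fin 3 → k) : SkewPoly k →ₐ[k] Matrix (Fin 2) (Fin 2) (SkewPoly k) :=
  lift (fun i => !![-x k i, algebraMap k _ (v i); 0, x k i]) <| by
    intro i j h
    have e := x_anticomm k h
    have c : ∀ r i, algebraMap k (SkewPoly k) r * x k i = x k i * algebraMap k _ r :=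
      fun r i => Algebra.commutes r _
    have e2 : -(x k i * algebraMap k _ (v j)) + v i • x k j +
        (-(x k j * algebraMap k _ (v i)) + v j • x k i) = 0 := by
      rw [← c, ← c, Algebra.smul_def, Algebra.smul_def]
      abel
    ext a b
    fin_cases a <;> fin_cases b <;> simp [e, e2]

theorem contractionHom_x (v : Fin 3 → k) (i : Fin 3) :
    contractionHom v (x k i) = !![-x k i, algebraMap k _ (v i); 0, x k i] := lift_x _ _ i

theorem contractionHom_one (v : Fin 3 → k) (a : SkewPoly k) :
    contractionHom v a 1 0 = 0 ∧ contractionHom v a 1 1 = a := by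
  induction a using left_induction with
  | algebraMap r => simp [Matrix.algebraMap_matrix_apply]
  | add a b ha hb => simp [ha, hb]
  | smul c a ha => simp [ha]
  | x_mul i a ha =>
    simp [contractionHom_x, Matrix.mul_apply, Fin.sum_univ_two, ha.1, ha.2]

/-- Contraction with `v`: the skew derivation of degree `-1` with `x i ↦ v i`. -/
def contraction (v : Fin 3 → k) : SkewPoly k →ₗ[k] SkewPoly k where
  toFun a := contractionHom v a 0 1
  map_add' a b := by simp
  map_smul' c a := by simp

theorem contraction_algebraMap (v : Fin 3 → k) (r : k) :
    contraction v (algebraMap k _ r) = 0 := by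
  change contractionHom v _ 0 1 = 0
  simp [Matrix.algebraMap_matrix_apply]

theorem contraction_one (v : Fin 3 → k) : contraction v 1 = 0 := by
  simpa using contraction_algebraMap v 1

theorem contraction_x_mul (v : Fin 3 → k) (i : Fin 3) (a : SkewPoly k) :
    contraction v (x k i * a) = v i • a - x k i * contraction v a := by
  change contractionHom v (x k i * a) 0 1 = v i • a - x k i * contractionHom v a 0 1
  rw [map_mul, contractionHom_x, Matrix.mul_apply, Fin.sum_univ_two, (contractionHom_one v a).2,
    Algebra.smul_def]
  simp only [Matrix.of_apply, Matrix.cons_val', Matrix.cons_val_zero, Matrix.cons_val_one,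
    neg_mul]
  abel

theorem contraction_x (v : Fin 3 → k) (i : Fin 3) :
    contraction v (x k i) = algebraMap k _ (v i) := by
  have := contraction_x_mul v i 1
  rwa [mul_one, contraction_one, mul_zero, sub_zero, ← Algebra.algebraMap_eq_smul_one] at this

theorem x_sq_mem_center (i : Fin 3) : x k i ^ 2 ∈ Subalgebra.center k (SkewPoly k) := by
  rw [Subalgebra.mem_center_iff]
  intro a
  induction a using left_induction with
  | algebraMap r => exact Algebra.commutes r _
  | add a b ha hb => rw [add_mul, mul_add, ha, hb]
  | smul c a ha => rw [smul_mul_assoc, mul_smul_comm, ha]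
  | x_mul j a ha => rw [mul_assoc, ha, ← mul_assoc, ← mul_assoc, x_sq_comm]

/-- The central homomorphism from the polynomial ring with `X i ↦ x i ^ 2`. -/
noncomputable def squares : MvPolynomial (Fin 3) k →+* SkewPoly k :=
  ((Subalgebra.center k (SkewPoly k)).val.comp
    (MvPolynomial.aeval fun i => ⟨x k i ^ 2, x_sq_mem_center i⟩)).toRingHom

theorem squares_X (i : Fin 3) : squares (X i) = x k i ^ 2 := by
  simp [squares]

theorem squares_C (r : k) : squares (C r) = algebraMap k (SkewPoly k) r :=
  ((Subalgebra.center k (SkewPoly k)).val.comp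
    (MvPolynomial.aeval fun i => ⟨x k i ^ 2, x_sq_mem_center i⟩)).commutes r

theorem squares_comm (p : MvPolynomial (Fin 3) k) (a : SkewPoly k) :
    squares p * a = a * squares p :=
  ((Subalgebra.mem_center_iff.1 (SetLike.coe_mem _)) a).symm

/-- In the contraction of `x i * (x i * a)` the two terms `v i • (x i * a)` have opposite signs and
cancel, so contraction is linear over the squares. -/
theorem contraction_squares_mul (v : Fin 3 → k) (p : MvPolynomial (Fin 3) k) (a : SkewPoly k) :
    contraction v (squares p * a) = squares p * contraction v a := by
  induction p using MvPolynomial.induction_on generalizing a with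
  | C r => rw [squares_C, ← Algebra.smul_def, ← Algebra.smul_def, map_smul]
  | add p q hp hq => rw [map_add, add_mul, add_mul, map_add, hp, hq]
  | mul_X p i hp =>
    rw [map_mul squares p (X i), mul_assoc, mul_assoc, hp, squares_X, pow_two, mul_assoc, contraction_x_mul,
      contraction_x_mul]
    simp only [mul_sub, mul_smul_comm, mul_assoc, sub_sub_cancel]

/-- Anticommuting matrices whose squares are the scalars `X j ^ 2`, if `i ^ 2 = -1`. -/
noncomputable def pauli (i : k) : Fin 3 → Matrix (Fin 2) (Fin 2) (MvPolynomial (Fin 3) k) :=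
  ![!![0, X 0; X 0, 0], !![X 1, 0; 0, -X 1], !![0, C i * X 2; -(C i * X 2), 0]]

theorem pauli_anticomm (i : k) (j l : Fin 3) (h : j ≠ l) :
    pauli i j * pauli i l + pauli i l * pauli i j = 0 := by
  refine Matrix.ext fun a b => ?_
  fin_cases j <;> fin_cases l <;> first
    | exact absurd rfl h
    | (fin_cases a <;> fin_cases b <;> (simp [pauli]; try ring))

theorem pauli_sq {i : k} (hi : i ^ 2 = -1) (j : Fin 3) :
    pauli i j ^ 2 = (X j : MvPolynomial (Fin 3) k) ^ 2 • 1 := by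
  have hi' : (C i : MvPolynomial (Fin 3) k) * C i = -1 := by
    rw [← map_mul, ← pow_two, hi, map_neg, map_one]
  refine Matrix.ext fun a b => ?_
  rw [pow_two, pow_two]
  fin_cases j <;> fin_cases a <;> fin_cases b <;>
    (simp [pauli, Matrix.mul_apply]; try linear_combination (-X 2 * X 2) * hi')

/-- The representation by `pauli` sends `squares p` to the scalar matrix of `p(X₀², X₁², X₂²)`, and
substituting squares of the variables is injective. Algebraic closedness supplies a square root of
`-1`. -/
theorem squares_injective [IsAlgClosed k] : Function.Injective (squares (k := k)) := by
  obtain ⟨i, hi⟩ := IsAlgClosed.exists_pow_nat_eq (-1 : k) (n := 2) (by norm_num)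
  have key : ∀ p : MvPolynomial (Fin 3) k, lift (pauli i) (pauli_anticomm i) (squares p) =
      MvPolynomial.expand 2 p • 1 := by
    intro p
    induction p using MvPolynomial.induction_on with
    | C r =>
      rw [squares_C, AlgHom.commutes, MvPolynomial.expand_C, Algebra.algebraMap_eq_smul_one,
        ← MvPolynomial.algebraMap_eq, algebraMap_smul]
    | add p q hp hq => rw [map_add, map_add, hp, hq, map_add, add_smul]
    | mul_X p j hp =>
      rw [map_mul, map_mul, hp, squares_X, map_pow, map_mul, MvPolynomial.expand_X, lift_x,
        pauli_sq hi, smul_mul_smul_comm, one_mul]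
  rw [injective_iff_map_eq_zero]
  intro p hp
  have := key p
  rw [hp, map_zero] at this
  have h00 := congrFun (congrFun this 0) 0
  simp only [Matrix.zero_apply, Matrix.smul_apply, Matrix.one_apply_eq, smul_eq_mul,
    mul_one] at h00
  exact (MvPolynomial.expand_eq_zero (by norm_num)).1 h00.symm

end SkewPoly

/-! ### Kernel and image of the contraction -/

namespace SkewPoly

open MvPolynomial (C X constantCoeff)

variable {k : Type u} [Field k]

/-- The closed elements `x j - l • x 0` of degree one. -/
def shifted (j : Fin 3) (l : k) : SkewPoly k := x k j - l • x k 0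

theorem shifted_mem (j : Fin 3) (l : k) : shifted j l ∈ grading k 1 :=
  sub_mem (x_mem k j) (Submodule.smul_mem _ l (x_mem k 0))

theorem contraction_shifted_mul (v : Fin 3 → k) (j : Fin 3) (l : k) (a : SkewPoly k) :
    contraction v (shifted j l * a) = (v j - l * v 0) • a - shifted j l * contraction v a := by
  rw [shifted, sub_mul, map_sub, smul_mul_assoc, map_smul, contraction_x_mul, contraction_x_mul,
    sub_mul, smul_mul_assoc, smul_sub, sub_smul, mul_smul]
  abel

theorem contraction_shifted (v : Fin 3 → k) (j : Fin 3) (l : k) :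
    contraction v (shifted j l) = algebraMap k _ (v j - l * v 0) := by
  have := contraction_shifted_mul v j l 1
  rwa [mul_one, contraction_one, mul_zero, sub_zero, ← Algebra.algebraMap_eq_smul_one] at this

theorem contraction_squares (v : Fin 3 → k) (p : MvPolynomial (Fin 3) k) :
    contraction v (squares p) = 0 := by
  have := contraction_squares_mul v p 1
  rwa [mul_one, contraction_one, mul_zero] at this

theorem x_mul_eq_neg {i j : Fin 3} (h : i ≠ j) : x k i * x k j = -(x k j * x k i) :=
  eq_neg_of_add_eq_zero_left (x_anticomm k h)

theorem smul_x_sq (r : k) (i : Fin 3) : r • x k i ^ 2 = squares (C r * X i) := by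
  rw [map_mul, squares_C, squares_X, Algebra.smul_def]

theorem shifted_sq {j : Fin 3} (hj : j ≠ 0) (l : k) :
    shifted j l * shifted j l = squares (X j + C (l ^ 2) * X 0) := by
  rw [map_add, squares_X, ← smul_x_sq, shifted, sub_mul, mul_sub, mul_sub, mul_smul_comm,
    smul_mul_assoc, smul_mul_smul_comm, x_mul_eq_neg hj, ← pow_two, ← pow_two, ← pow_two, smul_neg]
  abel

theorem shifted_anticomm {i j : Fin 3} (hi : i ≠ 0) (hj : j ≠ 0) (hij : i ≠ j) (l l' : k) :
    shifted i l * shifted j l' + shifted j l' * shifted i l = squares (C (2 * l * l') * X 0) := by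
  rw [← smul_x_sq, shifted, shifted, sub_mul, sub_mul, mul_sub, mul_sub, mul_sub, mul_sub]
  simp only [mul_smul_comm, smul_mul_assoc]
  rw [x_mul_eq_neg hi, x_mul_eq_neg hj, x_mul_eq_neg hij, smul_smul, smul_smul, mul_comm l' l,
    mul_assoc 2, two_mul, add_smul, pow_two]
  simp only [smul_neg]
  abel

theorem shifted_mul_x_zero {j : Fin 3} (hj : j ≠ 0) (l : k) :
    shifted j l * x k 0 = squares (C (-(2 * l)) * X 0) - x k 0 * shifted j l := by
  rw [← smul_x_sq, shifted, sub_mul, mul_sub, mul_smul_comm, smul_mul_assoc, x_mul_eq_neg hj,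
    neg_smul, two_mul, add_smul, pow_two]
  abel

theorem isCliffordPair (l₁ l₂ : k) :
    IsCliffordPair (squares (k := k)) (shifted 1 l₁) (shifted 2 l₂)
      (X 1 + C (l₁ ^ 2) * X 0) (X 2 + C (l₂ ^ 2) * X 0) (C (2 * l₁ * l₂) * X 0) where
  comm := squares_comm
  left_sq := shifted_sq (by decide) l₁
  right_sq := shifted_sq (by decide) l₂
  anticomm := shifted_anticomm (by decide) (by decide) (by decide) l₁ l₂

/-- Membership in the span, over the squares, of `1`, the two closed elements and their product. -/
def IsClosedForm (l₁ l₂ : k) (a : SkewPoly k) : Prop :=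
  ∃ c₀ c₁ c₂ c₃, a = squares c₀ + squares c₁ * shifted 1 l₁ + squares c₂ * shifted 2 l₂ +
    squares c₃ * (shifted 1 l₁ * shifted 2 l₂)

namespace IsClosedForm

variable {l₁ l₂ : k} {a b : SkewPoly k}

theorem zero : IsClosedForm l₁ l₂ 0 := ⟨0, 0, 0, 0, by simp⟩

theorem add (ha : IsClosedForm l₁ l₂ a) (hb : IsClosedForm l₁ l₂ b) :
    IsClosedForm l₁ l₂ (a + b) := by
  obtain ⟨c₀, c₁, c₂, c₃, rfl⟩ := ha
  obtain ⟨d₀, d₁, d₂, d₃, rfl⟩ := hb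
  refine ⟨c₀ + d₀, c₁ + d₁, c₂ + d₂, c₃ + d₃, ?_⟩
  simp only [map_add, add_mul]
  abel

theorem squares_mul (p : MvPolynomial (Fin 3) k) (ha : IsClosedForm l₁ l₂ a) :
    IsClosedForm l₁ l₂ (squares p * a) := by
  obtain ⟨c₀, c₁, c₂, c₃, rfl⟩ := ha
  exact ⟨_, _, _, _, IsCliffordPair.scalar_mul _ _ p c₀ c₁ c₂ c₃⟩

theorem smul (r : k) (ha : IsClosedForm l₁ l₂ a) : IsClosedForm l₁ l₂ (r • a) := by
  rw [Algebra.smul_def, ← squares_C]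
  exact ha.squares_mul _

theorem neg (ha : IsClosedForm l₁ l₂ a) : IsClosedForm l₁ l₂ (-a) := by
  simpa using ha.smul (-1)

theorem left_mul (ha : IsClosedForm l₁ l₂ a) : IsClosedForm l₁ l₂ (shifted 1 l₁ * a) := by
  obtain ⟨c₀, c₁, c₂, c₃, rfl⟩ := ha
  exact ⟨_, _, _, _, (isCliffordPair l₁ l₂).left_mul c₀ c₁ c₂ c₃⟩

theorem right_mul (ha : IsClosedForm l₁ l₂ a) : IsClosedForm l₁ l₂ (shifted 2 l₂ * a) := by
  obtain ⟨c₀, c₁, c₂, c₃, rfl⟩ := ha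
  exact ⟨_, _, _, _, (isCliffordPair l₁ l₂).right_mul c₀ c₁ c₂ c₃⟩

theorem contraction_eq_zero (ha : IsClosedForm l₁ l₂ a) : contraction ![1, l₁, l₂] a = 0 := by
  obtain ⟨c₀, c₁, c₂, c₃, rfl⟩ := ha
  simp [contraction_squares_mul, contraction_squares, contraction_shifted_mul, contraction_shifted]

end IsClosedForm

/-- The sum `B + x_0 B` is stable under left multiplication by each generator: write `x_j` as
`shifted j l + l • x_0`, move `x_0` to the left of `shifted j l` at the cost of a multiple of
`x_0²`, and absorb `x_0²` into the squares. -/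
theorem exists_eq_add_x_zero_mul (l₁ l₂ : k) (a : SkewPoly k) :
    ∃ b b', IsClosedForm l₁ l₂ b ∧ IsClosedForm l₁ l₂ b' ∧ a = b + x k 0 * b' := by
  induction a using left_induction with
  | algebraMap r =>
    exact ⟨_, 0, ⟨C r, 0, 0, 0, rfl⟩, .zero, by simp [squares_C]⟩
  | add a a' ha ha' =>
    obtain ⟨b, b', hb, hb', rfl⟩ := ha
    obtain ⟨c, c', hc, hc', rfl⟩ := ha'
    exact ⟨b + c, b' + c', hb.add hc, hb'.add hc', by rw [mul_add]; abel⟩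
  | smul r a ha =>
    obtain ⟨b, b', hb, hb', rfl⟩ := ha
    exact ⟨r • b, r • b', hb.smul r, hb'.smul r, by rw [smul_add, mul_smul_comm]⟩
  | x_mul i a ha =>
    obtain ⟨b, b', hb, hb', rfl⟩ := ha
    have h0 : x k 0 * (b + x k 0 * b') = squares (X 0) * b' + x k 0 * b := by
      rw [mul_add, ← mul_assoc, ← pow_two, squares_X, add_comm]
    have hs : ∀ (j : Fin 3) (l : k), j ≠ 0 → x k j * (b + x k 0 * b') =
        (shifted j l * b + squares (C (-(2 * l)) * X 0) * b' + l • (squares (X 0) * b')) +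
          x k 0 * (l • b + -(shifted j l * b')) := by
      intro j l hj
      have e : x k j = shifted j l + l • x k 0 := (sub_add_cancel _ _).symm
      have e2 : shifted j l * (x k 0 * b') =
          squares (C (-(2 * l)) * X 0) * b' - x k 0 * (shifted j l * b') := by
        rw [← mul_assoc, shifted_mul_x_zero hj, sub_mul, mul_assoc]
      conv_lhs => rw [e, add_mul, mul_add, e2, smul_mul_assoc, h0]
      rw [smul_add, mul_add, mul_smul_comm, mul_neg]
      abel
    fin_cases i
    · exact ⟨_, _, hb'.squares_mul _, hb, h0⟩
    · exact ⟨_, _, (hb.left_mul.add (hb'.squares_mul _)).add ((hb'.squares_mul _).smul l₁),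
        (hb.smul l₁).add hb'.left_mul.neg, hs 1 l₁ (by decide)⟩
    · exact ⟨_, _, (hb.right_mul.add (hb'.squares_mul _)).add ((hb'.squares_mul _).smul l₂),
        (hb.smul l₂).add hb'.right_mul.neg, hs 2 l₂ (by decide)⟩

/-- Since `v` has first entry `1`, the contraction of `b + x_0 b'` is `b'`. The same computation
gives the kernel below. -/
theorem isClosedForm_contraction (l₁ l₂ : k) (a : SkewPoly k) :
    IsClosedForm l₁ l₂ (contraction ![1, l₁, l₂] a) := by
  obtain ⟨b, b', hb, hb', rfl⟩ := exists_eq_add_x_zero_mul l₁ l₂ a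
  rw [map_add, hb.contraction_eq_zero, contraction_x_mul, hb'.contraction_eq_zero]
  simpa using hb'

theorem contraction_eq_zero_iff (l₁ l₂ : k) (a : SkewPoly k) :
    contraction ![1, l₁, l₂] a = 0 ↔ IsClosedForm l₁ l₂ a := by
  refine ⟨fun h => ?_, IsClosedForm.contraction_eq_zero⟩
  obtain ⟨b, b', hb, hb', rfl⟩ := exists_eq_add_x_zero_mul l₁ l₂ a
  rw [map_add, hb.contraction_eq_zero, contraction_x_mul, hb'.contraction_eq_zero] at h
  have h' : b' = 0 := by simpa using h
  rwa [h', mul_zero, add_zero]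

theorem exists_contraction_eq {l₁ l₂ : k} {a : SkewPoly k} (ha : IsClosedForm l₁ l₂ a) :
    contraction ![1, l₁, l₂] (x k 0 * a) = a := by
  rw [contraction_x_mul, ha.contraction_eq_zero]
  simp

/-- Contractions along the last two coordinate vectors do not see the shift by `x_0`; each removes
one of the two closed elements. Applying both isolates `c₃`, then each alone gives `c₂` and `c₁`,
and injectivity of `squares` finishes. -/
theorem closedForm_coeff_eq_zero [IsAlgClosed k] (l₁ l₂ : k) (c₀ c₁ c₂ c₃ : MvPolynomial (Fin 3) k)
    (h : squares c₀ + squares c₁ * shifted 1 l₁ + squares c₂ * shifted 2 l₂ +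
      squares c₃ * (shifted 1 l₁ * shifted 2 l₂) = 0) :
    c₀ = 0 ∧ c₁ = 0 ∧ c₂ = 0 ∧ c₃ = 0 := by
  have inj := injective_iff_map_eq_zero (squares (k := k)) |>.1 squares_injective
  have h1 := congrArg (contraction ![0, 0, 1]) h
  simp only [map_add, contraction_squares, contraction_squares_mul, contraction_shifted_mul,
    contraction_shifted, map_zero] at h1
  have h2 := congrArg (contraction ![0, 1, 0]) h1
  have h3 := congrArg (contraction ![0, 1, 0]) h
  simp [contraction_squares, contraction_squares_mul, contraction_shifted_mul,
    contraction_shifted] at h1 h2 h3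
  have z3 := inj _ h2
  subst z3
  simp only [map_zero, zero_mul, neg_zero, add_zero] at h1 h3 h
  have z2 := inj _ h1
  subst z2
  have z1 := inj _ h3
  subst z1
  simp only [map_zero, zero_mul, add_zero] at h
  exact ⟨inj _ h, rfl, rfl, rfl⟩

end SkewPoly

/-! ### The cohomology algebra for a matrix of rank one -/

namespace SkewPoly

open MvPolynomial (C X constantCoeff)

variable {k : Type u} [Field k]

/-- The linear form with coefficients `m`. -/
noncomputable def linearForm (m : Fin 3 → k) : MvPolynomial (Fin 3) k := ∑ j, C (m j) * X j

theorem linearForm_ne_zero {m : Fin 3 → k} {p : Fin 3} (hp : m p ≠ 0) : linearForm m ≠ 0 := by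
  intro h
  have := congrArg (MvPolynomial.eval (Pi.single p 1)) h
  simp [linearForm, Pi.single_apply] at this
  exact hp this

theorem squares_linearForm (m : Fin 3 → k) : squares (linearForm m) = ∑ j, m j • x k j ^ 2 := by
  rw [linearForm, map_sum]
  exact Finset.sum_congr rfl fun j _ => (smul_x_sq _ _).symm

/-- The substitution that solves `linearForm m = 0` for the variable `X p`. -/
noncomputable def eliminate (m : Fin 3 → k) (p : Fin 3) :
    MvPolynomial (Fin 3) k →ₐ[k] MvPolynomial (Fin 2) k :=
  MvPolynomial.aeval (p.insertNth (-∑ i, C (m (p.succAbove i) / m p) * X i) X)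

theorem eliminate_X_same (m : Fin 3 → k) (p : Fin 3) :
    eliminate m p (X p) = -∑ i, C (m (p.succAbove i) / m p) * X i := by
  simp [eliminate]

theorem eliminate_X_succAbove (m : Fin 3 → k) (p : Fin 3) (i : Fin 2) :
    eliminate m p (X (p.succAbove i)) = X i := by
  simp [eliminate]

theorem eliminate_rename (m : Fin 3 → k) (p : Fin 3) (c : MvPolynomial (Fin 2) k) :
    eliminate m p (MvPolynomial.rename p.succAbove c) = c := by
  induction c using MvPolynomial.induction_on with
  | C r => rw [MvPolynomial.rename_C]; exact (eliminate m p).commutes r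
  | add c d hc hd => rw [map_add, map_add, hc, hd]
  | mul_X c i hc => rw [map_mul, map_mul, hc, MvPolynomial.rename_X, eliminate_X_succAbove]

theorem eliminate_linearForm {m : Fin 3 → k} {p : Fin 3} (hp : m p ≠ 0) :
    eliminate m p (linearForm m) = 0 := by
  have hC : ∀ r : k, eliminate m p (C r) = C r := (eliminate m p).commutes
  rw [linearForm, Fin.sum_univ_succAbove _ p, map_add, map_mul, hC, eliminate_X_same, map_sum,
    mul_neg, Finset.mul_sum, neg_add_eq_zero]
  refine Finset.sum_congr rfl fun i _ => ?_
  rw [map_mul, hC, eliminate_X_succAbove, ← mul_assoc, ← map_mul, mul_div_cancel₀ _ hp]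

/-- `X p` is replaced by a form without constant term. This keeps the Clifford scalars in the
augmentation ideal. -/
theorem constantCoeff_eliminate (m : Fin 3 → k) (p : Fin 3) (c : MvPolynomial (Fin 3) k) :
    constantCoeff (eliminate m p c) = constantCoeff c := by
  induction c using MvPolynomial.induction_on with
  | C r =>
    rw [show eliminate m p (C r) = C r from (eliminate m p).commutes r]
    simp
  | add c d hc hd => rw [map_add, map_add, map_add, hc, hd]
  | mul_X c i hc =>
    rw [map_mul, map_mul, map_mul, hc]
    congr 1
    rcases Fin.eq_self_or_eq_succAbove p i with rfl | ⟨i, rfl⟩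
    · simp [eliminate_X_same]
    · simp [eliminate_X_succAbove]

/-- The augmentation `x i ↦ 0`. -/
def augmentation : SkewPoly k →ₐ[k] k := lift (fun _ => 0) fun _ _ _ => by simp

theorem augmentation_of_mem {n : ℕ} {a : SkewPoly k} (ha : a ∈ grading k n) (hn : 0 < n) :
    augmentation a = 0 := by
  have key : 0 < n → augmentation a = 0 := by
    clear hn
    induction ha using grading_induction with
    | algebraMap r => exact fun h => absurd h (lt_irrefl 0)
    | add n a b _ _ _ iha ihb => exact fun h => by rw [map_add, iha h, ihb h, add_zero]
    | smul n c a _ _ iha => exact fun h => by rw [map_smul, iha h, smul_zero]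
    | x_mul n i a _ _ _ =>
      intro _
      rw [map_mul, show augmentation (x k i) = 0 from lift_x _ _ i, zero_mul]
  exact key hn

theorem augmentation_squares (c : MvPolynomial (Fin 3) k) :
    augmentation (squares c) = constantCoeff c := by
  induction c using MvPolynomial.induction_on with
  | C r => rw [squares_C, AlgHom.commutes]; simp
  | add c d hc hd => rw [map_add, map_add, map_add, hc, hd]
  | mul_X c i hc =>
    rw [map_mul, map_mul, squares_X, map_pow,
      show augmentation (x k i) = 0 from lift_x _ _ i]
    simp

/-! ### Cocycles, coboundaries and the Clifford structure on cohomology -/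

section

variable {M : Matrix (Fin 3) (Fin 3) k} {m : Fin 3 → k} {l₁ l₂ : k}
  (hM : ∀ i j, M i j = (![1, l₁, l₂] : Fin 3 → k) i * m j)
include hM

/-- As the linear form in the squares is central, its product with the contraction is again a skew
derivation, and it agrees with the differential on the generators. -/
theorem dg_d_eq (a : SkewPoly k) :
    (dg M).d a = squares (linearForm m) * contraction ![1, l₁, l₂] a := by
  have hx : ∀ i, (dg M).d (x k i) = (![1, l₁, l₂] : Fin 3 → k) i • squares (linearForm m) := by
    intro i
    rw [dg_d_x, squares_linearForm, Finset.smul_sum]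
    exact Finset.sum_congr rfl fun j _ => by rw [hM, mul_smul]
  induction a using left_induction with
  | algebraMap r =>
    rw [contraction_algebraMap, mul_zero, Algebra.algebraMap_eq_smul_one, map_smul,
      (dg M).d_one, smul_zero]
  | add a b ha hb => rw [map_add, map_add, mul_add, ha, hb]
  | smul r a ha => rw [map_smul, map_smul, mul_smul_comm, ha]
  | x_mul i a ha =>
    rw [(dg M).leibniz 1 _ _ (x_mem k i), hx, ha, contraction_x_mul, mul_sub, pow_one, neg_one_mul,
      smul_mul_assoc, mul_smul_comm, ← mul_assoc, ← mul_assoc, squares_comm _ (x k i),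
      sub_eq_add_neg]

/-- The contraction of `a` lies in the free module of closed forms, on which the nonzero linear form
acts injectively; so `∂ a = 0` exactly when the contraction vanishes. -/
theorem mem_cocycles_iff [IsAlgClosed k] {p : Fin 3} (hp : m p ≠ 0) (a : SkewPoly k) :
    a ∈ (dg M).cocycles ↔ IsClosedForm l₁ l₂ a := by
  rw [DGStructure.mem_cocycles, dg_d_eq hM, ← contraction_eq_zero_iff]
  refine ⟨fun h => ?_, fun h => by rw [h, mul_zero]⟩
  obtain ⟨c₀, c₁, c₂, c₃, hc⟩ := isClosedForm_contraction l₁ l₂ a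
  rw [hc, IsCliffordPair.scalar_mul] at h
  obtain ⟨h0, h1, h2, h3⟩ := closedForm_coeff_eq_zero l₁ l₂ _ _ _ _ h
  have z : ∀ c, linearForm m * c = 0 → c = 0 := fun c hc =>
    (mul_eq_zero.1 hc).resolve_left (linearForm_ne_zero hp)
  rw [hc, z _ h0, z _ h1, z _ h2, z _ h3]
  simp

theorem exists_d_eq_iff (a : SkewPoly k) :
    (∃ b, (dg M).d b = a) ↔ ∃ c, IsClosedForm l₁ l₂ c ∧ squares (linearForm m) * c = a := by
  constructor
  · rintro ⟨b, rfl⟩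
    exact ⟨_, isClosedForm_contraction l₁ l₂ b, (dg_d_eq hM b).symm⟩
  · rintro ⟨c, hc, rfl⟩
    exact ⟨x k 0 * c, by rw [dg_d_eq hM, exists_contraction_eq hc]⟩

theorem squares_mem_cocycles (c : MvPolynomial (Fin 3) k) : squares c ∈ (dg M).cocycles := by
  rw [DGStructure.mem_cocycles, dg_d_eq hM, contraction_squares, mul_zero]

theorem shifted_one_mem_cocycles : shifted 1 l₁ ∈ (dg M).cocycles := by
  rw [DGStructure.mem_cocycles, dg_d_eq hM, contraction_shifted]
  simp

theorem shifted_two_mem_cocycles : shifted 2 l₂ ∈ (dg M).cocycles := by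
  rw [DGStructure.mem_cocycles, dg_d_eq hM, contraction_shifted]
  simp

variable {E : Type u} [Ring E] [Algebra k E] (cl : (dg M).cocycles →ₐ[k] E)

/-- The map from the polynomial ring on the squares to the cohomology algebra. -/
noncomputable def squaresClass : MvPolynomial (Fin 3) k →+* E :=
  cl.toRingHom.comp
    (squares.codRestrict (dg M).cocycles (squares_mem_cocycles hM))

theorem squaresClass_apply (c : MvPolynomial (Fin 3) k) :
    squaresClass hM cl c = cl ⟨squares c, squares_mem_cocycles hM c⟩ := rfl

theorem squaresClass_C (r : k) : squaresClass hM cl (C r) = algebraMap k _ r := by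
  rw [squaresClass_apply, ← AlgHom.commutes cl]
  congr 1
  exact Subtype.ext (squares_C r)

theorem squaresClass_linearForm (hk : ∀ z, cl z = 0 ↔ ∃ a, (dg M).d a = z) : squaresClass hM cl (linearForm m) = 0 := by
  rw [squaresClass_apply, hk]
  -- The first entry of `v` is `1`, so `∂(x_0)` is the linear form itself.
  refine ⟨x k 0, ?_⟩
  rw [dg_d_eq hM, contraction_x]
  simp

/-- The map from the polynomial ring in two variables to the cohomology algebra. -/
noncomputable def polynomialClass (p : Fin 3) : MvPolynomial (Fin 2) k →+* E :=
  (squaresClass hM cl).comp (MvPolynomial.rename p.succAbove).toRingHom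

theorem polynomialClass_C (p : Fin 3) (r : k) :
    polynomialClass hM cl p (C r) = algebraMap k _ r := by
  rw [← squaresClass_C hM cl]
  exact congrArg (squaresClass hM cl) (MvPolynomial.rename_C _ r)

theorem polynomialClass_X (p : Fin 3) (i : Fin 2) :
    polynomialClass hM cl p (X i) = squaresClass hM cl (X (p.succAbove i)) :=
  congrArg (squaresClass hM cl) (MvPolynomial.rename_X _ i)

/-- The linear form is a coboundary, so in cohomology the class of `x_p²` equals the combination
that `eliminate` substitutes for `X p`. -/
theorem squaresClass_eq (hk : ∀ z, cl z = 0 ↔ ∃ a, (dg M).d a = z) {p : Fin 3} (hp : m p ≠ 0) (c : MvPolynomial (Fin 3) k) :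
    squaresClass hM cl c = polynomialClass hM cl p (eliminate m p c) := by
  have hC : ∀ r : k, eliminate m p (C r) = C r := (eliminate m p).commutes
  induction c using MvPolynomial.induction_on with
  | C r => rw [hC, squaresClass_C, polynomialClass_C]
  | add c d hc hd => rw [map_add, map_add, map_add, hc, hd]
  | mul_X c i hc =>
    rw [map_mul, map_mul, map_mul, hc]
    congr 1
    rcases Fin.eq_self_or_eq_succAbove p i with rfl | ⟨i, rfl⟩
    · have e := squaresClass_linearForm hM cl hk
      rw [linearForm, Fin.sum_univ_succAbove _ i, map_add, map_mul, squaresClass_C, map_sum,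
        ← Algebra.smul_def, add_eq_zero_iff_eq_neg] at e
      rw [eliminate_X_same, map_neg, map_sum, ← inv_smul_smul₀ hp (squaresClass hM cl (X i)), e,
        smul_neg, Finset.smul_sum]
      congr 1
      refine Finset.sum_congr rfl fun j _ => ?_
      rw [map_mul, map_mul, squaresClass_C, polynomialClass_C, polynomialClass_X,
        ← Algebra.smul_def, ← Algebra.smul_def, smul_smul, div_eq_inv_mul]
    · rw [eliminate_X_succAbove, polynomialClass_X]

/-- The class of `shifted 1 l₁`. -/
noncomputable def leftClass : E :=
  cl ⟨shifted 1 l₁, shifted_one_mem_cocycles hM⟩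

/-- The class of `shifted 2 l₂`. -/
noncomputable def rightClass : E :=
  cl ⟨shifted 2 l₂, shifted_two_mem_cocycles hM⟩

theorem cohomologyClass_closedForm {z : (dg M).cocycles} {c₀ c₁ c₂ c₃ : MvPolynomial (Fin 3) k}
    (hz : (z : SkewPoly k) = squares c₀ + squares c₁ * shifted 1 l₁ + squares c₂ * shifted 2 l₂ +
      squares c₃ * (shifted 1 l₁ * shifted 2 l₂)) :
    cl z = squaresClass hM cl c₀ + squaresClass hM cl c₁ * leftClass hM cl +
      squaresClass hM cl c₂ * rightClass hM cl +
      squaresClass hM cl c₃ * (leftClass hM cl * rightClass hM cl) := by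
  simp only [squaresClass_apply, leftClass, rightClass, ← map_mul, ← map_add]
  congr 1
  exact Subtype.ext hz

/-- The ring `E` enters only as the quotient of the cocycles by the coboundaries, through `hs` and
`hk`. The relations and the spanning property descend from the closed forms; independence needs the
description of the coboundaries. -/
theorem isRankTwoClifford (hs : Function.Surjective cl)
    (hk : ∀ z, cl z = 0 ↔ ∃ a, (dg M).d a = z) [IsAlgClosed k] {p : Fin 3} (hp : m p ≠ 0) :
    IsRankTwoClifford (polynomialClass hM cl p) (leftClass hM cl) (rightClass hM cl)
      (eliminate m p (X 1 + C (l₁ ^ 2) * X 0)) (eliminate m p (X 2 + C (l₂ ^ 2) * X 0))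
      (eliminate m p (C (2 * l₁ * l₂) * X 0)) where
  comm c e := by
    obtain ⟨z, rfl⟩ := hs e
    change cl _ * _ = _ * cl _
    rw [← map_mul, ← map_mul]
    congr 1
    exact Subtype.ext (squares_comm _ _)
  left_sq := by
    rw [← squaresClass_eq hM cl hk hp, squaresClass_apply, leftClass, ← map_mul]
    congr 1
    exact Subtype.ext (isCliffordPair l₁ l₂).left_sq
  right_sq := by
    rw [← squaresClass_eq hM cl hk hp, squaresClass_apply, rightClass, ← map_mul]
    congr 1
    exact Subtype.ext (isCliffordPair l₁ l₂).right_sq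
  anticomm := by
    rw [← squaresClass_eq hM cl hk hp, squaresClass_apply, leftClass, rightClass, ← map_mul, ← map_mul,
      ← map_add]
    congr 1
    exact Subtype.ext (isCliffordPair l₁ l₂).anticomm
  exists_coeff e := by
    obtain ⟨z, rfl⟩ := hs e
    obtain ⟨c₀, c₁, c₂, c₃, hc⟩ := (mem_cocycles_iff hM hp _).1 z.2
    refine ⟨eliminate m p c₀, eliminate m p c₁, eliminate m p c₂, eliminate m p c₃, ?_⟩
    simp only [← squaresClass_eq hM cl hk hp]
    exact cohomologyClass_closedForm hM cl hc
  coeff_eq_zero c₀ c₁ c₂ c₃ h := by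
    let f : MvPolynomial (Fin 2) k → MvPolynomial (Fin 3) k := MvPolynomial.rename p.succAbove
    have hz : IsClosedForm l₁ l₂ (squares (f c₀) + squares (f c₁) * shifted 1 l₁ +
      squares (f c₂) * shifted 2 l₂ + squares (f c₃) * (shifted 1 l₁ * shifted 2 l₂)) :=
      ⟨_, _, _, _, rfl⟩
    have h' := (cohomologyClass_closedForm hM cl
      (z := ⟨_, (mem_cocycles_iff hM hp _).2 hz⟩) rfl).trans h
    obtain ⟨_, ⟨d₀, d₁, d₂, d₃, rfl⟩, hd⟩ :=
      (exists_d_eq_iff hM _).1 ((hk _).1 h')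
    rw [IsCliffordPair.scalar_mul, ← sub_eq_zero] at hd
    obtain ⟨h0, h1, h2, h3⟩ := closedForm_coeff_eq_zero l₁ l₂ (linearForm m * d₀ - f c₀)
      (linearForm m * d₁ - f c₁) (linearForm m * d₂ - f c₂) (linearForm m * d₃ - f c₃) (by
        simp only [map_sub, sub_mul]
        refine Eq.trans ?_ hd
        change _ = _ - (_ + _ + _ + _)
        abel)
    -- `eliminate` kills multiples of the linear form and is a left inverse of the renaming `f`, so
    -- no nonzero polynomial in the remaining two variables is such a multiple.
    have z : ∀ c d, linearForm m * d - f c = 0 → c = 0 := fun c d e => by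
      rw [← eliminate_rename m p c, show MvPolynomial.rename p.succAbove c = _ from
        (sub_eq_zero.1 e).symm, map_mul, eliminate_linearForm hp, zero_mul]
    exact ⟨z _ _ h0, z _ _ h1, z _ _ h2, z _ _ h3⟩

theorem isConnectedGraded_cohomology [IsAlgClosed k] {p : Fin 3} (hp : m p ≠ 0) :
    IsConnectedGraded (dg M).cohomologyGrading := by
  constructor
  · exact (isRankTwoClifford hM (dg M).cohomologyClass (dg M).cohomologyClass_surjective
      (fun _ => (dg M).cohomologyClass_eq_zero) hp).nontrivial
  · refine le_antisymm ?_ ?_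
    · rintro e he
      obtain ⟨z, hz, rfl⟩ := (dg M).mem_cohomologyGrading.1 he
      rw [grading, pow_zero] at hz
      obtain ⟨r, hr⟩ := Submodule.mem_one.1 hz
      refine Submodule.mem_one.2 ⟨r, ?_⟩
      rw [← AlgHom.commutes (dg M).cohomologyClass]
      congr 1
      exact Subtype.ext hr
    · rw [Submodule.one_le]
      exact SetLike.GradedOne.one_mem

theorem isASGorenstein_cohomology [IsAlgClosed k] {p : Fin 3} (hp : m p ≠ 0) :
    IsASGorenstein (dg M).cohomologyGrading := by
  have hc := isConnectedGraded_cohomology hM hp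
  have h := isRankTwoClifford hM (dg M).cohomologyClass (dg M).cohomologyClass_surjective
      (fun _ => (dg M).cohomologyClass_eq_zero) hp
  have sq : ∀ i, squaresClass hM (dg M).cohomologyClass (X i) ∈ positivePart (dg M).cohomologyGrading := fun i =>
    ⟨2, by norm_num, (dg M).mem_cohomologyGrading.2 ⟨_, by
      change squares (X i) ∈ grading k 2
      rw [squares_X, pow_two]
      exact SetLike.GradedMul.mul_mem (x_mem k i) (x_mem k i), rfl⟩⟩
  obtain ⟨hl, hr⟩ := h.extOneInjFinite_and_op (polynomialClass_C hM (dg M).cohomologyClass p)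
    (by rw [constantCoeff_eliminate]; simp) (by rw [constantCoeff_eliminate]; simp)
    (by rw [constantCoeff_eliminate]; simp) (S := positivePart (dg M).cohomologyGrading) (by
      rintro _ (rfl | rfl | rfl | rfl)
      · exact ⟨1, one_pos, (dg M).mem_cohomologyGrading.2 ⟨_, shifted_mem 1 l₁, rfl⟩⟩
      · exact ⟨1, one_pos, (dg M).mem_cohomologyGrading.2 ⟨_, shifted_mem 2 l₂, rfl⟩⟩
      · rw [polynomialClass_X]; exact sq _
      · rw [polynomialClass_X]; exact sq _) (by
      rintro e ⟨n, hn, he⟩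
      obtain ⟨z, hz, rfl⟩ := (dg M).mem_cohomologyGrading.1 he
      obtain ⟨c₀, c₁, c₂, c₃, hc⟩ := (mem_cocycles_iff hM hp _).1 z.2
      refine ⟨eliminate m p c₀, eliminate m p c₁, eliminate m p c₂, eliminate m p c₃, ?_, ?_⟩
      · have h0 := augmentation_of_mem hz hn
        have hs : ∀ j l, augmentation (shifted j l : SkewPoly k) = 0 := fun j l =>
          augmentation_of_mem (shifted_mem j l) one_pos
        rw [constantCoeff_eliminate, ← augmentation_squares, ← h0]
        change _ = augmentation (z : SkewPoly k)
        rw [hc]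
        simp [hs]
      · simp only [← squaresClass_eq hM (dg M).cohomologyClass
          (fun _ => (dg M).cohomologyClass_eq_zero) hp]
        exact cohomologyClass_closedForm hM (dg M).cohomologyClass hc)
  exact ⟨⟨hc, hl⟩, ⟨hc, hr⟩⟩

end

end SkewPoly

/-! ### The theorem for a matrix of rank one -/

theorem mainTheorem6 {k : Type u} [Field k] [IsAlgClosed k] [CharZero k]
    (m₁₁ m₁₂ m₁₃ l₁ l₂ : k) (hm : (m₁₁, m₁₂, m₁₃) ≠ (0, 0, 0))
    (M : Matrix (Fin 3) (Fin 3) k)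
    (hM : M = !![m₁₁, m₁₂, m₁₃; l₁ * m₁₁, l₁ * m₁₂, l₁ * m₁₃; l₂ * m₁₁, l₂ * m₁₂, l₂ * m₁₃]) :
    (ListedCondition m₁₁ m₁₂ m₁₃ l₁ l₂ → IsASGorenstein (SkewPoly.dg M).cohomologyGrading) ∧
    (ListedCondition m₁₁ m₁₂ m₁₃ l₁ l₂ ↔
      ¬ (l₁ * l₂ ≠ 0 ∧
        ((m₁₂ * m₁₃ = 0 ∧ m₁₂ * l₁ ^ 2 + m₁₃ * l₂ ^ 2 = m₁₁) ∨
         (m₁₂ * l₁ ^ 2 + m₁₃ * l₂ ^ 2 ≠ m₁₁ ∧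
          4 * m₁₂ * m₁₃ * l₁ ^ 2 * l₂ ^ 2 = (m₁₂ * l₁ ^ 2 + m₁₃ * l₂ ^ 2 - m₁₁) ^ 2)))) := by
  constructor
  · intro _
    obtain ⟨p, hp⟩ : ∃ p, (![m₁₁, m₁₂, m₁₃] : Fin 3 → k) p ≠ 0 := by
      by_contra! h
      exact hm (Prod.ext (h 0) (Prod.ext (h 1) (h 2)))
    refine SkewPoly.isASGorenstein_cohomology (m := ![m₁₁, m₁₂, m₁₃]) (l₁ := l₁) (l₂ := l₂)
      (fun i j => ?_) hp
    subst hM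
    fin_cases i <;> fin_cases j <;> simp
  · unfold ListedCondition
    -- Once the vanishing of `l₁` and of `l₂` is decided, only propositional combinations of the
    -- remaining equations are left.
    by_cases h1 : l₁ = 0 <;> by_cases h2 : l₂ = 0 <;>
      simp only [h1, h2, mul_eq_zero, ne_eq, not_or] <;> tauto
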